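/- Let $M=\mathcal M_\theta$ (for a fixed value $\theta$ of the control parameters) be a simply connected smooth manifold of dimension $n$ (Hausdorff, second countable, without boundary points of its own), with a Riemannian metric $g_{ij}$ of class $C^2$ and invariant volume element $d\mu=\sqrt{|\det(g_{ij}/2\pi)|}\,dI$. Let $\mathcal S:M\to\mathbb R$ (the information potential) be a differentiable function such that $dp=e^{\mathcal S}\,d\mu$ is a probability distribution on $M$. A geodesic with unitary affine parametrization is a $C^1$ curve $I_g:[a,b]\to M$ ($a<b$) with $g_{ij}\dot I_g^i\dot I_g^j=1$ whose length is minimal among the curves in $M$ with the same end points, i.e. equal to the Riemannian distance $\mathfrak D(I_g(a),I_g(b))$ (the infimum of the lengths of $C^1$ curves joining these points); the information dissipation along it is $\Phi(t)=\frac{d}{dt}\mathcal S(I_g(t))$. Suppose that (i) along every geodesic with unitary affine parametrization, the length of each interval $(t_1,t_2)$ is $\Delta s=\Phi(t_1)-\Phi(t_2)$; (ii) the probability weight $\omega=e^{\mathcal S}$ vanishes on the boundary of $M$ (points at infinity included), i.e. for every $\varepsilon>0$ there is a compact set $K\subset M$ with $\omega<\varepsilon$ outside $K$ (no condition if $M$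 is compact). Then $\mathcal S$ has exactly one stationary point $\bar I$ in $M$ (a point where all the derivatives $\partial\mathcal S/\partial I^i$ vanish), and $\bar I$ is the global maximum: $\mathcal S(I)<\mathcal S(\bar I)$ for every $I\in M$, $I\neq\bar I$. -/

import Mathlib

open Set Filter Topology MeasureTheory Manifold Bundle
open scoped ContDiff ENNReal

noncomputable section

namespace FluctuationGeometry

/-! Throughout, `M` is an `n`-dimensional manifold without boundary points, modelled on `ℝⁿ`. The
`RiemannianBundle` instance is the metric tensor `g`: `inner ℝ v w` is `g(v, w)` for tangent vectors
`v`, `w` at the same point. -/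

variable {n : ℕ} {M : Type*} [TopologicalSpace M] [ChartedSpace (EuclideanSpace ℝ (Fin n)) M]

/-- The velocity at time `t` of a curve `γ` defined on `[a, b]` (one-sided at the end points). -/
def velocity (γ : ℝ → M) (a b t : ℝ) : TangentSpace (𝓡 n) (γ t) :=
  mfderivWithin 𝓘(ℝ, ℝ) (𝓡 n) γ (Icc a b) t (1 : ℝ)

/-- The information dissipation `Φ(t) = dS(γ(t))/dt` of the potential `S` along a curve `γ` defined
on `[a, b]` (one-sided at the end points). -/
def dissipation (S : M → ℝ) (γ : ℝ → M) (a b t : ℝ) : ℝ :=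
  derivWithin (fun s => S (γ s)) (Icc a b) t

/-- `x` is a stationary point of `S`: all first partial derivatives of `S` vanish at `x`. -/
def IsStationaryPoint (n : ℕ) {M : Type*} [TopologicalSpace M]
    [ChartedSpace (EuclideanSpace ℝ (Fin n)) M] (S : M → ℝ) (x : M) : Prop :=
  mfderiv (𝓡 n) 𝓘(ℝ, ℝ) S x = 0

/-- The probability weight `ω = exp S` of the information potential `S`. -/
def probabilityWeight (S : M → ℝ) (x : M) : ℝ := Real.exp (S x)

/-- `γ : [a, b] → M` is a geodesic with unitary affine parametrization: it is continuously
differentiable, `g(γ', γ') = 1`, and its length is minimal among all curves with the same end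
points, that is, equal to the Riemannian distance (the infimum of these lengths). -/
structure IsUnitGeodesic (n : ℕ) {M : Type*} [TopologicalSpace M]
    [ChartedSpace (EuclideanSpace ℝ (Fin n)) M]
    [RiemannianBundle (fun x : M => TangentSpace (𝓡 n) x)] (γ : ℝ → M) (a b : ℝ) : Prop where
  contMDiffOn : ContMDiffOn 𝓘(ℝ, ℝ) (𝓡 n) 1 γ (Icc a b)
  unit_speed : ∀ t ∈ Icc a b,
    inner ℝ (velocity (n := n) γ a b t) (velocity (n := n) γ a b t) = 1
  minimal : pathELength (𝓡 n) γ a b = riemannianEDist (𝓡 n) (γ a) (γ b)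

/-- Along every geodesic with unitary affine parametrization, the length of each interval
`[t₁, t₂]` is the negative `Φ(t₁) - Φ(t₂)` of the variation of the information dissipation. -/
def LengthIsDissipationLoss (n : ℕ) {M : Type*} [TopologicalSpace M]
    [ChartedSpace (EuclideanSpace ℝ (Fin n)) M]
    [RiemannianBundle (fun x : M => TangentSpace (𝓡 n) x)] (S : M → ℝ) : Prop :=
  ∀ (γ : ℝ → M) (a b : ℝ), a < b → IsUnitGeodesic n γ a b →
    ∀ t₁ ∈ Icc a b, ∀ t₂ ∈ Icc a b, t₁ < t₂ →
      (pathELength (𝓡 n) γ t₁ t₂).toReal = dissipation S γ a b t₁ - dissipation S γ a b t₂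

/-- The `i`-th coordinate vector field `∂ᵢ` of the chart `e`, at the point with coordinates `y`. -/
def coordVector (e : OpenPartialHomeomorph M (EuclideanSpace ℝ (Fin n)))
    (y : EuclideanSpace ℝ (Fin n)) (i : Fin n) : TangentSpace (𝓡 n) (e.symm y) :=
  mfderiv (𝓡 n) (𝓡 n) e.symm y (EuclideanSpace.single i (1 : ℝ))

variable [RiemannianBundle (fun x : M => TangentSpace (𝓡 n) x)]

/-- The matrix `gᵢⱼ = g(∂ᵢ, ∂ⱼ)` of the metric tensor in the chart `e`, at the point with
coordinates `y`. -/
def metricMatrix (e : OpenPartialHomeomorph M (EuclideanSpace ℝ (Fin n)))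
    (y : EuclideanSpace ℝ (Fin n)) : Matrix (Fin n) (Fin n) ℝ :=
  Matrix.of fun i j => inner ℝ (coordVector e y i) (coordVector e y j)

/-- `μ` is the invariant volume element: in each chart, `dμ = √|det (gᵢⱼ / 2π)| dI`, where `dI` is
Lebesgue measure in the coordinates. -/
def IsInvariantVolume (n : ℕ) {M : Type*} [TopologicalSpace M]
    [ChartedSpace (EuclideanSpace ℝ (Fin n)) M]
    [RiemannianBundle (fun x : M => TangentSpace (𝓡 n) x)] [MeasurableSpace M]
    (μ : Measure M) : Prop :=
  ∀ e ∈ atlas (EuclideanSpace ℝ (Fin n)) M, ∀ A : Set M, MeasurableSet A → A ⊆ e.source →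
    μ A = ∫⁻ y in e '' A,
      ENNReal.ofReal (Real.sqrt |((2 * Real.pi)⁻¹ • metricMatrix e y).det|)

end FluctuationGeometry

end

/-! The weight `exp S` is continuous, positive and vanishes at infinity, so it attains a maximum at
some `p`, which is stationary. Suppose a unit speed minimizing geodesic of length `D = dist p y > 0`
joins `p` to `y`. The dissipation is zero at `p`, so the length hypothesis forces `Φ(t) = -t` along
the curve. Integrating, `S y = S p - D ^ 2 / 2`, and `Φ(D) = -D ≠ 0` shows that `y` is not
stationary (`potential_eq_of_isSegment`).

Such geodesics have to be produced without assuming completeness. Balls about `p` are relatively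
compact by induction on the radius (`exists_isCompact_ball_subset`): if all smaller balls are, the
formula for `S` holds in the ball of radius `R`, hence `S ≥ S p - R ^ 2 / 2` there, and the decay of
the weight confines the ball to a compact set. Relative compactness yields minimizing segments as
limits of almost minimizing curves (`exists_segment_of_ball_subset_isCompact`).

These limits are only isometric images of intervals, whereas the hypothesis concerns `C^1` curves.
Regularity is obtained without the geodesic equation. In a chart the metric is Lipschitz, so
distances at scale `h` agree with a frozen Euclidean norm up to a factor `1 + O(h)`; the
parallelogram law then bounds second differences of a segment by `O(h ^ (3/2))`, which forces `C^1`
(`contDiffOn_of_secondDifference_le`). -/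

namespace FluctuationGeometry

/-! ### Second differences of order `h ^ (3/2)` imply `C^1`. -/

section SecondDifference

variable {F : Type*} [NormedAddCommGroup F] [NormedSpace ℝ F] [CompleteSpace F]

/-- A continuous curve with second differences `O(h ^ (3/2))` agrees with a `C^1` curve away from
the right end point. -/
lemma exists_contDiff_eqOn_of_secondDifference_le {f : ℝ → F} {a b c C : ℝ} (hac : a ≤ c)
    (hcb : c < b) (hf : ContinuousOn f (Icc a b))
    (hC : ∀ t h, 0 < h → t - h ∈ Icc a b → t + h ∈ Icc a b →
      ‖f (t + h) - (2 : ℝ) • f t + f (t - h)‖ ≤ C * (h * √h)) :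
    ∃ g : ℝ → F, ContDiff ℝ 1 g ∧ EqOn f g (Icc a c) := by
  have hab : a ≤ b := hac.trans hcb.le
  set φ : ℝ → F := IccExtend hab ((Icc a b).domRestrict f) with hφ
  have hφc : Continuous φ := (continuousOn_iff_continuous_domRestrict.1 hf).Icc_extend'
  have hφf : ∀ t ∈ Icc a b, φ t = f t := fun t ht => by
    rw [hφ, IccExtend_of_mem hab _ ht]; rfl
  have hbc : 0 < b - c := sub_pos.2 hcb
  -- Dyadic steps, at most `b - c`, so that `t + h k` stays in `[a, b]` for every `t ≤ c`.
  set h : ℕ → ℝ := fun k => (b - c) / 2 ^ k with hh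
  have hpos : ∀ k, 0 < h k := fun k => by positivity
  have hle : ∀ k, h k ≤ b - c := fun k => div_le_self hbc.le (one_le_pow₀ one_le_two)
  have hsucc : ∀ k, h k = h (k + 1) + h (k + 1) := fun k => by
    simp only [hh, pow_succ]; field_simp; norm_num
  have hlim : Tendsto h atTop (𝓝[≠] 0) := by
    refine tendsto_nhdsWithin_iff.2 ⟨?_, Eventually.of_forall fun k => (hpos k).ne'⟩
    have := (tendsto_pow_atTop_nhds_zero_of_lt_one (r := (1 / 2 : ℝ)) (by norm_num)
      (by norm_num)).const_mul (b - c)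
    simpa [hh, div_eq_mul_inv] using this
  let q : ℕ → C(Icc a c, F) := fun k =>
    ⟨fun t => (h k)⁻¹ • (φ (t + h k) - φ t), by fun_prop⟩
  -- Consecutive dyadic quotients differ by half a second difference divided by the step, hence by
  -- `O(√h)`, which is geometric in `k`.
  have hq : ∀ k, dist (q k) (q (k + 1)) ≤ (|C| * √(b - c)) * (√(1 / 2)) ^ k := by
    intro k
    rw [ContinuousMap.dist_le (by positivity)]
    rintro ⟨t, ht⟩
    have h1 := hpos (k + 1)
    have h2 := hle k
    rw [hsucc k] at h2
    have e0 : φ t = f (t + h (k + 1) - h (k + 1)) := by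
      rw [hφf t ⟨ht.1, ht.2.trans hcb.le⟩]; ring_nf
    have e1 : φ (t + h (k + 1)) = f (t + h (k + 1)) :=
      hφf _ ⟨by linarith [ht.1], by linarith [ht.2]⟩
    have e2 : φ (t + h k) = f (t + h (k + 1) + h (k + 1)) := by
      rw [hφf _ ⟨by linarith [ht.1, hpos k], by linarith [ht.2, hle k]⟩, hsucc k]; ring_nf
    have key := hC (t + h (k + 1)) (h (k + 1)) h1 ⟨by linarith [ht.1], by linarith [ht.2]⟩
      ⟨by linarith [ht.1], by linarith [ht.2]⟩
    have e3 : q k ⟨t, ht⟩ - q (k + 1) ⟨t, ht⟩ = (h (k + 1))⁻¹ • ((1 / 2 : ℝ) •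
        (f (t + h (k + 1) + h (k + 1)) - (2 : ℝ) • f (t + h (k + 1))
          + f (t + h (k + 1) - h (k + 1)))) := by
      change (h k)⁻¹ • (φ (t + h k) - φ t) - (h (k + 1))⁻¹ • (φ (t + h (k + 1)) - φ t) = _
      have : (h k)⁻¹ = (1 / 2) * (h (k + 1))⁻¹ := by rw [hsucc k]; field_simp; norm_num
      rw [e0, e1, e2, this]
      module
    rw [dist_eq_norm, e3, norm_smul, norm_smul]
    have hs : √(h (k + 1)) ≤ √(b - c) * (√(1 / 2)) ^ k := by
      refine Real.sqrt_le_iff.2 ⟨by positivity, ?_⟩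
      rw [mul_pow, ← pow_mul, mul_comm k, pow_mul, Real.sq_sqrt hbc.le, Real.sq_sqrt (by norm_num)]
      have := hsucc k
      have h4 : h (k + 1) ≤ h k := by linarith
      refine h4.trans (le_of_eq ?_)
      simp [hh, div_eq_mul_inv]
    rw [norm_inv, Real.norm_of_nonneg h1.le, Real.norm_of_nonneg (by norm_num : (0:ℝ) ≤ 1 / 2)]
    calc (h (k + 1))⁻¹ * (1 / 2 * ‖f (t + h (k + 1) + h (k + 1)) - (2 : ℝ) • f (t + h (k + 1))
          + f (t + h (k + 1) - h (k + 1))‖)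
        ≤ (h (k + 1))⁻¹ * (1 * (|C| * (h (k + 1) * √(h (k + 1))))) := by
          gcongr
          · norm_num
          · exact key.trans (by gcongr; exact le_abs_self C)
      _ = |C| * √(h (k + 1)) := by field_simp
      _ ≤ _ := by rw [mul_assoc]; gcongr
  have hr : √(1 / 2 : ℝ) < 1 := by
    rw [Real.sqrt_lt' one_pos]; norm_num
  obtain ⟨D, hD⟩ := cauchySeq_tendsto_of_complete (cauchySeq_of_le_geometric _ _ hr hq)
  set d : ℝ → F := IccExtend hac D with hd
  have hdc : Continuous d := D.continuous.Icc_extend'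
  -- The uniform limit `d` of the difference quotients is the derivative: integrals of the quotients
  -- tend both to `f s - f a` and to the integral of `d`.
  refine ⟨fun s => f a + ∫ t in a..s, d t, ?_, fun s hs => ?_⟩
  · rw [contDiff_one_iff_deriv]
    have hder : ∀ s, HasDerivAt (fun s => f a + ∫ t in a..s, d t) (d s) s := fun s =>
      (hdc.integral_hasStrictDerivAt a s).hasDerivAt.const_add _
    refine ⟨fun s => (hder s).differentiableAt, ?_⟩
    rw [show deriv (fun s => f a + ∫ t in a..s, d t) = d from funext fun s => (hder s).deriv]
    exact hdc
  · have hav : ∀ u, Tendsto (fun k => (h k)⁻¹ • ∫ t in u..(u + h k), φ t) atTop (𝓝 (φ u)) := by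
      intro u
      have := (hasDerivAt_iff_tendsto_slope_zero.1
        (hφc.integral_hasStrictDerivAt u u).hasDerivAt).comp hlim
      simpa [Function.comp_def] using this
    have hint : ∀ k, ∫ t in a..s, (h k)⁻¹ • (φ (t + h k) - φ t)
        = (h k)⁻¹ • (∫ t in s..(s + h k), φ t) - (h k)⁻¹ • ∫ t in a..(a + h k), φ t := by
      intro k
      have i1 : ∀ u v, IntervalIntegrable φ volume u v := fun u v => hφc.intervalIntegrable u v
      rw [intervalIntegral.integral_smul, intervalIntegral.integral_sub
        ((by fun_prop : Continuous fun t => φ (t + h k)).intervalIntegrable _ _) (i1 _ _),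
        intervalIntegral.integral_comp_add_right, ← smul_sub]
      congr 1
      have A1 := intervalIntegral.integral_add_adjacent_intervals (i1 a (a + h k))
        (i1 (a + h k) (s + h k))
      have A2 := intervalIntegral.integral_add_adjacent_intervals (i1 a s) (i1 s (s + h k))
      rw [← A1] at A2
      rw [sub_eq_sub_iff_add_eq_add, add_comm _ (∫ t in a..(a + h k), φ t), ← A2, add_comm]
    have l1 : Tendsto (fun k => ∫ t in a..s, (h k)⁻¹ • (φ (t + h k) - φ t)) atTop
        (𝓝 (f s - f a)) := by
      simp_rw [hint]
      rw [← hφf s ⟨hs.1, hs.2.trans hcb.le⟩, ← hφf a ⟨le_rfl, hab⟩]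
      exact (hav s).sub (hav a)
    have l2 : Tendsto (fun k => ∫ t in a..s, (h k)⁻¹ • (φ (t + h k) - φ t)) atTop
        (𝓝 (∫ t in a..s, d t)) := by
      rw [tendsto_iff_norm_sub_tendsto_zero]
      have hz : Tendsto (fun k => dist (q k) D * |s - a|) atTop (𝓝 0) := by
        simpa using (tendsto_iff_dist_tendsto_zero.1 hD).mul_const |s - a|
      refine squeeze_zero (fun _ => norm_nonneg _) (fun k => ?_) hz
      rw [← intervalIntegral.integral_sub
        ((by fun_prop : Continuous fun t => (h k)⁻¹ • (φ (t + h k) - φ t)).intervalIntegrable _ _)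
        (hdc.intervalIntegrable _ _)]
      refine intervalIntegral.norm_integral_le_of_norm_le_const fun t ht => ?_
      rw [uIoc_of_le hs.1] at ht
      have htc : t ∈ Icc a c := ⟨ht.1.le, ht.2.trans hs.2⟩
      rw [hd, IccExtend_of_mem hac _ htc, ← dist_eq_norm]
      exact ContinuousMap.dist_apply_le_dist (f := q k) (g := D) ⟨t, htc⟩
    have := tendsto_nhds_unique l1 l2
    simp only [← this]
    abel

/-- A continuous curve on `[a, b]` with second differences `O(h ^ (3/2))` is `C^1`. -/
lemma contDiffOn_of_secondDifference_le {f : ℝ → F} {a b C : ℝ} (hab : a < b)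
    (hf : ContinuousOn f (Icc a b))
    (hC : ∀ t h, 0 < h → t - h ∈ Icc a b → t + h ∈ Icc a b →
      ‖f (t + h) - (2 : ℝ) • f t + f (t - h)‖ ≤ C * (h * √h)) :
    ContDiffOn ℝ 1 f (Icc a b) := by
  have main : ∀ {g : ℝ → F} {a b : ℝ}, ContinuousOn g (Icc a b) →
      (∀ t h, 0 < h → t - h ∈ Icc a b → t + h ∈ Icc a b →
        ‖g (t + h) - (2 : ℝ) • g t + g (t - h)‖ ≤ C * (h * √h)) →
      ∀ x ∈ Ico a b, ContDiffWithinAt ℝ 1 g (Icc a b) x := by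
    intro g a b hg hC x hx
    obtain ⟨G, hG, hE⟩ := exists_contDiff_eqOn_of_secondDifference_le (c := (x + b) / 2)
      (by linarith [hx.1, hx.2]) (by linarith [hx.2]) hg hC
    have h1 : ContDiffWithinAt ℝ 1 g (Icc a ((x + b) / 2)) x :=
      hG.contDiffWithinAt.congr hE (hE ⟨hx.1, by linarith [hx.2]⟩)
    refine h1.mono_of_mem_nhdsWithin ?_
    have : Iic ((x + b) / 2) ∈ 𝓝 x := Iic_mem_nhds (by linarith [hx.2])
    filter_upwards [self_mem_nhdsWithin, mem_nhdsWithin_of_mem_nhds this] with y hy hy'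
    exact ⟨hy.1, hy'⟩
  intro x hx
  rcases hx.2.lt_or_eq with hxb | rfl
  · exact main hf hC x ⟨hx.1, hxb⟩
  -- The right end point follows from the left one by the reflection `t ↦ -t`, under which second
  -- differences are invariant.
  · have hneg : ∀ {y : ℝ}, y ∈ Icc (-x) (-a) → -y ∈ Icc a x := fun {y} hy =>
      ⟨by linarith [hy.2], by linarith [hy.1]⟩
    have h1 := main (g := fun t => f (-t)) (a := -x) (b := -a)
      (hf.comp continuous_neg.continuousOn fun y hy => hneg hy)
      (fun t h hh h1 h2 => by
        have := hC (-t) h hh (by rw [show -t - h = -(t + h) by ring]; exact hneg h2)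
          (by rw [show -t + h = -(t - h) by ring]; exact hneg h1)
        rw [show -(t + h) = -t - h by ring, show -(t - h) = -t + h by ring]
        convert this using 2
        abel) (-x) ⟨le_rfl, by linarith⟩
    have h2 := ContDiffWithinAt.comp (n := 1) x (g := fun t => f (-t)) (f := fun t : ℝ => -t)
      (s := Icc a x) (t := Icc (-x) (-a)) h1 contDiff_neg.contDiffWithinAt
      (fun y hy => ⟨by linarith [hy.2], by linarith [hy.1]⟩)
    simpa [Function.comp_def] using h2

end SecondDifference

/-! ### Minimizing segments and compact balls in length spaces. -/

section LengthSpace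

variable {X : Type*} [MetricSpace X]

/-- Any two points are joined by curves, parametrized on an interval of length arbitrarily close to
their distance, that do not increase distances. -/
def HasShortCurves (X : Type*) [MetricSpace X] : Prop :=
  ∀ (x y : X) (L : ℝ), dist x y < L → ∃ c : ℝ → X, c 0 = x ∧ c L = y ∧
    ∀ s ∈ Icc 0 L, ∀ t ∈ Icc 0 L, dist (c s) (c t) ≤ |s - t|

/-- In a length space, a point in a relatively compact ball is joined to the centre by a
minimizing segment. -/
lemma exists_segment_of_ball_subset_isCompact (hX : HasShortCurves X) {p y : X} {R : ℝ} {K : Set X}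
    (hK : IsCompact K) (hball : Metric.ball p R ⊆ K) (hy : dist p y < R) :
    ∃ c : ℝ → X, c 0 = p ∧ c (dist p y) = y ∧
      ∀ s ∈ Icc 0 (dist p y), ∀ t ∈ Icc 0 (dist p y), dist (c s) (c t) = |s - t| := by
  rcases eq_or_ne p y with rfl | hpy
  · refine ⟨fun _ => p, rfl, rfl, fun s hs t ht => ?_⟩
    simp only [dist_self, Icc_self, mem_singleton_iff] at hs ht
    simp [hs, ht]
  set D := dist p y with hD
  have hDpos : 0 < D := dist_pos.2 hpy
  obtain ⟨u, -, hu, hulim⟩ := exists_seq_strictAnti_tendsto' hy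
  choose c hc0 hcL hc using fun k => hX p y (u k) (hu k).1
  have hmem : ∀ k, ∀ s ∈ Icc 0 D, s * (u k / D) ∈ Icc 0 (u k) := fun k s hs => by
    have hr : 0 ≤ u k / D := div_nonneg (hDpos.trans (hu k).1).le hDpos.le
    refine ⟨mul_nonneg hs.1 hr, ?_⟩
    calc s * (u k / D) ≤ D * (u k / D) := mul_le_mul_of_nonneg_right hs.2 hr
      _ = u k := by field_simp
  set g : ℕ → ℝ → X := fun k s => c k (s * (u k / D)) with hg
  have hgdist : ∀ k, ∀ s ∈ Icc 0 D, ∀ t ∈ Icc 0 D, dist (g k s) (g k t) ≤ |s - t| * (u k / D) := by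
    intro k s hs t ht
    refine (hc k _ (hmem k s hs) _ (hmem k t ht)).trans (le_of_eq ?_)
    rw [← sub_mul, abs_mul, abs_of_pos (div_pos (hDpos.trans (hu k).1) hDpos)]
  have hg0 : ∀ k, g k 0 = p := fun k => by simp [hg, hc0]
  have hgD : ∀ k, g k D = y := fun k => by
    simp only [hg, mul_div_cancel₀ _ hDpos.ne', hcL]
  have hgK : ∀ k, ∀ s ∈ Icc 0 D, g k s ∈ K := by
    intro k s hs
    apply hball
    rw [Metric.mem_ball', ← hc0 k]
    refine (hc k _ ⟨le_rfl, (hDpos.trans (hu k).1).le⟩ _ (hmem k s hs)).trans_lt ?_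
    rw [zero_sub, abs_neg, abs_of_nonneg (hmem k s hs).1]
    exact (hmem k s hs).2.trans_lt (hu k).2
  -- Pointwise limits along one ultrafilter replace an Arzelà–Ascoli extraction; the Lipschitz
  -- bounds pass to the limit.
  have hex : ∀ s ∈ Icc 0 D, ∃ x, Tendsto (fun k => g k s) (hyperfilter ℕ) (𝓝 x) := by
    intro s hs
    obtain ⟨x, -, hx⟩ := hK.ultrafilter_le_nhds ((hyperfilter ℕ).map fun k => g k s)
      (le_principal_iff.2 <| Ultrafilter.mem_map.2 <| Eventually.of_forall fun k => hgK k s hs)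
    exact ⟨x, hx⟩
  have : Nonempty X := ⟨p⟩
  choose! f hf using hex
  have hulim' : Tendsto u (hyperfilter ℕ) (𝓝 D) :=
    hulim.mono_left (by rw [← Nat.cofinite_eq_atTop]; exact hyperfilter_le_cofinite)
  have h0 : (0 : ℝ) ∈ Icc 0 D := ⟨le_rfl, hDpos.le⟩
  have h1 : D ∈ Icc 0 D := ⟨hDpos.le, le_rfl⟩
  have hf0 : f 0 = p := tendsto_nhds_unique (hf 0 h0) (by simp only [hg0]; exact tendsto_const_nhds)
  have hfD : f D = y := tendsto_nhds_unique (hf D h1) (by simp only [hgD]; exact tendsto_const_nhds)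
  have hle : ∀ s ∈ Icc 0 D, ∀ t ∈ Icc 0 D, dist (f s) (f t) ≤ |s - t| := by
    intro s hs t ht
    have l1 := (hf s hs).dist (hf t ht)
    have l2 : Tendsto (fun k => |s - t| * (u k / D)) (hyperfilter ℕ) (𝓝 (|s - t| * (D / D))) :=
      (hulim'.div_const D).const_mul _
    rw [div_self hDpos.ne', mul_one] at l2
    exact le_of_tendsto_of_tendsto' l1 l2 fun k => hgdist k s hs t ht
  refine ⟨f, hf0, hfD, ?_⟩
  -- A `1`-Lipschitz curve of parameter length `D` between points at distance `D` saturates the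
  -- triangle inequality.
  have key : ∀ s ∈ Icc 0 D, ∀ t ∈ Icc 0 D, s ≤ t → |s - t| ≤ dist (f s) (f t) := by
    intro s hs t ht hst
    have a1 := hle 0 h0 s hs
    have a2 := hle t ht D h1
    rw [hf0, zero_sub, abs_neg, abs_of_nonneg hs.1] at a1
    rw [hfD, abs_sub_comm, abs_of_nonneg (sub_nonneg.2 ht.2)] at a2
    have a3 := dist_triangle4 p (f s) (f t) y
    rw [abs_sub_comm, abs_of_nonneg (sub_nonneg.2 hst)]
    linarith
  intro s hs t ht
  refine le_antisymm (hle s hs t ht) ?_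
  rcases le_total s t with h | h
  · exact key s hs t ht h
  · rw [abs_sub_comm, dist_comm]; exact key t ht s hs h

/-- In a locally compact length space, if relative compactness of balls centred at `p` passes from
the smaller radii to each radius, then all balls centred at `p` are relatively compact. -/
lemma exists_isCompact_ball_subset [LocallyCompactSpace X] (hX : HasShortCurves X) (p : X)
    (hstep : ∀ R, (∀ r < R, ∃ K, IsCompact K ∧ Metric.ball p r ⊆ K) →
      ∃ K, IsCompact K ∧ Metric.ball p R ⊆ K) (R : ℝ) :
    ∃ K, IsCompact K ∧ Metric.ball p R ⊆ K := by
  set A : Set ℝ := {r | ∃ K, IsCompact K ∧ Metric.ball p r ⊆ K} with hA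
  have hdown : ∀ {r s}, r ≤ s → s ∈ A → r ∈ A := fun hrs ⟨K, hK, h⟩ =>
    ⟨K, hK, (Metric.ball_subset_ball hrs).trans h⟩
  have h0 : (0 : ℝ) ∈ A := ⟨∅, isCompact_empty, by simp⟩
  by_contra hR
  have hbdd : BddAbove A := ⟨R, fun r hr => le_of_not_ge fun h => hR (hdown h hr)⟩
  obtain ⟨K, hK, hKs⟩ := hstep (sSup A) fun r hr => by
    obtain ⟨s, hs, hrs⟩ := exists_lt_of_lt_csSup ⟨0, h0⟩ hr
    exact hdown hrs.le hs
  obtain ⟨δ, hδ, hKδ⟩ := hK.exists_isCompact_cthickening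
  rcases (le_csSup hbdd h0).lt_or_eq with hpos | hzero
  swap
  · obtain ⟨K', hK', hp⟩ := exists_compact_mem_nhds p
    obtain ⟨ε, hε, hεK⟩ := Metric.mem_nhds_iff.1 hp
    exact absurd (le_csSup hbdd ⟨K', hK', hεK⟩) (by linarith)
  -- A short curve to `y` is still in `K` at time `t`, and its remaining length is at most `3 * δ /
  -- 4`, so `y` lies in the compact `δ`-thickening of `K`. This exceeds the supremum.
  have : sSup A + δ / 2 ∈ A := by
    refine ⟨_, hKδ, fun y hy => ?_⟩
    rw [Metric.mem_ball'] at hy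
    obtain ⟨c, hc0, hcL, hc⟩ := hX p y _ hy
    set t := max 0 (sSup A - δ / 4) with ht
    have ht0 : 0 ≤ t := le_max_left _ _
    have ht1 : t < sSup A := max_lt hpos (by linarith)
    have htm : t ∈ Icc 0 (sSup A + δ / 2) := ⟨ht0, by linarith⟩
    have hct : c t ∈ K := by
      apply hKs
      rw [Metric.mem_ball', ← hc0]
      refine (hc 0 ⟨le_rfl, by linarith⟩ t htm).trans_lt ?_
      rwa [zero_sub, abs_neg, abs_of_nonneg ht0]
    refine Metric.mem_cthickening_of_dist_le y (c t) δ K hct ?_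
    rw [dist_comm, ← hcL]
    refine (hc t htm _ ⟨by linarith, le_rfl⟩).trans ?_
    rw [abs_sub_comm, abs_of_nonneg (by linarith)]
    linarith [le_max_right 0 (sSup A - δ / 4)]
  linarith [le_csSup hbdd this]

end LengthSpace

/-! ### The metric of a Riemannian bundle in a trivialization. -/

section Bundle

variable {EB : Type*} [NormedAddCommGroup EB] [NormedSpace ℝ EB]
  {HB : Type*} [TopologicalSpace HB] {IB : ModelWithCorners ℝ EB HB} {k : ℕ∞ω}
  {B : Type*} [TopologicalSpace B] [ChartedSpace HB B]
  {F : Type*} [NormedAddCommGroup F] [NormedSpace ℝ F]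
  {E : B → Type*} [TopologicalSpace (TotalSpace F E)] [∀ x, NormedAddCommGroup (E x)]
  [∀ x, InnerProductSpace ℝ (E x)] [FiberBundle F E] [VectorBundle ℝ F E]

/-- The metric of a `C^k` Riemannian bundle is `C^k` when read in a trivialization. -/
lemma exists_contMDiffAt_metric [h : IsContMDiffRiemannianBundle IB k F E] (x₀ : B) :
    ∃ G : B → F →L[ℝ] F →L[ℝ] ℝ, ContMDiffAt IB 𝓘(ℝ, F →L[ℝ] F →L[ℝ] ℝ) k G x₀ ∧
      ∀ y ∈ (trivializationAt F E x₀).baseSet, ∀ v : F,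
        G y v v = ‖(trivializationAt F E x₀).symmL ℝ y v‖ ^ 2 := by
  obtain ⟨g, hg, hgi⟩ := h.exists_contMDiff
  refine ⟨fun y => ContinuousLinearMap.inCoordinates F E (F →L[ℝ] ℝ)
    (fun x => E x →L[ℝ] ℝ) x₀ y x₀ y (g y), ?_, fun y hy v => ?_⟩
  · have W := hg.contMDiffAt (x := x₀)
    rw [contMDiffAt_hom_bundle] at W
    exact W.2
  · rw [inCoordinates_apply_eq₂ hy hy (Set.mem_univ _), ← real_inner_self_eq_norm_sq, hgi]
    simp [hy]

lemma Trivialization.norm_le_mul_norm_symmL (x₀ : B) {y : B}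
    (hy : y ∈ (trivializationAt F E x₀).baseSet) (v : F) :
    ‖v‖ ≤ ‖(trivializationAt F E x₀).continuousLinearMapAt ℝ y‖ *
      ‖(trivializationAt F E x₀).symmL ℝ y v‖ := by
  conv_lhs => rw [← (trivializationAt F E x₀).continuousLinearMapAt_symmL (R := ℝ) hy v]
  exact ContinuousLinearMap.le_opNorm _ _

/-- The pull-back of a Euclidean norm under a linear map is the pull-back of the norm of any
Euclidean space of the same dimension. -/
lemma exists_clm_norm_eq {n : ℕ} {V : Type*} [NormedAddCommGroup V] [InnerProductSpace ℝ V]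
    [FiniteDimensional ℝ V] (hV : Module.finrank ℝ V = n) (D : F →L[ℝ] V) :
    ∃ A : F →L[ℝ] EuclideanSpace ℝ (Fin n), ∀ v, ‖A v‖ = ‖D v‖ :=
  let b := (stdOrthonormalBasis ℝ V).reindex (finCongr hV)
  ⟨(b.repr.toContinuousLinearEquiv : V →L[ℝ] EuclideanSpace ℝ (Fin n)).comp D,
    fun _ => b.repr.norm_map _⟩

lemma le_mul_of_norm_bilin_sub_le {G G' : F →L[ℝ] F →L[ℝ] ℝ} {v : F} {a b c δ : ℝ} (hb : 0 ≤ b)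
    (hδ : 0 ≤ δ) (hG : a ^ 2 = G v v) (hG' : b ^ 2 = G' v v) (h : dist G G' ≤ δ)
    (hv : ‖v‖ ≤ c * b) : a ≤ (1 + c ^ 2 * δ) * b := by
  have hcb : 0 ≤ c * b := (norm_nonneg v).trans hv
  replace h : ‖G - G'‖ ≤ δ := (dist_eq_norm G G').symm.trans_le h
  have h1 : a ^ 2 ≤ (1 + c ^ 2 * δ) * b ^ 2 := by
    calc a ^ 2 = (G - G') v v + b ^ 2 := by rw [hG, hG']; simp
      _ ≤ ‖G - G'‖ * ‖v‖ * ‖v‖ + b ^ 2 := by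
        gcongr; exact (Real.le_norm_self _).trans (ContinuousLinearMap.le_opNorm₂ _ _ _)
      _ ≤ δ * (c * b) * (c * b) + b ^ 2 := by gcongr
      _ = _ := by ring
  -- The square root of `1 + x` is estimated by `1 + x ≤ (1 + x) ^ 2`.
  have : 0 ≤ c ^ 2 * δ := by positivity
  refine le_of_sq_le_sq (h1.trans ?_) (by positivity)
  rw [mul_pow]
  gcongr
  nlinarith

end Bundle

/-! ### Lipschitz control of the Riemannian norm in a chart. -/

section Chart

variable {n : ℕ} {M : Type*} [TopologicalSpace M] [ChartedSpace (EuclideanSpace ℝ (Fin n)) M]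
  [RiemannianBundle (fun x : M => TangentSpace (𝓡 n) x)]

lemma isContinuousRiemannianBundle_of_contMDiff [IsManifold (𝓡 n) 1 M]
    [h : IsContMDiffRiemannianBundle (𝓡 n) 1 (EuclideanSpace ℝ (Fin n))
      (fun x : M => TangentSpace (𝓡 n) x)] :
    IsContinuousRiemannianBundle (EuclideanSpace ℝ (Fin n))
      (fun x : M => TangentSpace (𝓡 n) x) := by
  obtain ⟨g, hg, hg'⟩ := h.exists_contMDiff
  exact ⟨g, hg.continuous, hg'⟩

/-- On the closed ball of radius `r` in the chart at `x₀`, the Riemannian norm read in the chart is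
`v ↦ ‖A z v‖`; it is bounded below by `m` and depends on `z` in a Lipschitz way. -/
structure ChartNormBounds (x₀ : M) (r C m : ℝ)
    (A : EuclideanSpace ℝ (Fin n) → EuclideanSpace ℝ (Fin n) →L[ℝ] EuclideanSpace ℝ (Fin n)) :
    Prop where
  radius_pos : 0 < r
  const_nonneg : 0 ≤ C
  bound_pos : 0 < m
  subset_target : Metric.closedBall (extChartAt (𝓡 n) x₀ x₀) r ⊆ (extChartAt (𝓡 n) x₀).target
  norm_eq : ∀ z ∈ Metric.closedBall (extChartAt (𝓡 n) x₀ x₀) r, ∀ v : EuclideanSpace ℝ (Fin n),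
    ‖A z v‖ = ‖mfderivWithin (𝓡 n) (𝓡 n) (extChartAt (𝓡 n) x₀).symm (range (𝓡 n)) z v‖
  le_norm : ∀ z ∈ Metric.closedBall (extChartAt (𝓡 n) x₀ x₀) r, ∀ v : EuclideanSpace ℝ (Fin n),
    m * ‖v‖ ≤ ‖A z v‖
  norm_le : ∀ z ∈ Metric.closedBall (extChartAt (𝓡 n) x₀ x₀) r,
    ∀ z' ∈ Metric.closedBall (extChartAt (𝓡 n) x₀ x₀) r, ∀ v : EuclideanSpace ℝ (Fin n),
    ‖A z v‖ ≤ (1 + C * ‖z - z'‖) * ‖A z' v‖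

/-- The metric tensor is `C^1` in the chart, hence locally Lipschitz. Together with a local bound
`B` on the trivialization this turns an additive estimate of quadratic forms into the multiplicative
one, with `C = K * B ^ 2` and `m = B⁻¹`. -/
lemma exists_chartNormBounds [IsManifold (𝓡 n) 2 M] [IsManifold (𝓡 n) 1 M]
    [IsContMDiffRiemannianBundle (𝓡 n) 1 (EuclideanSpace ℝ (Fin n))
      (fun x : M => TangentSpace (𝓡 n) x)] (x₀ : M) :
    ∃ r C m A, ChartNormBounds (n := n) x₀ r C m A := by
  have := isContinuousRiemannianBundle_of_contMDiff (n := n) (M := M)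
  set z₀ := extChartAt (𝓡 n) x₀ x₀ with hz₀
  set τ := trivializationAt (EuclideanSpace ℝ (Fin n)) (fun x : M => TangentSpace (𝓡 n) x) x₀
    with hτ
  obtain ⟨g, hg, hgn⟩ := exists_contMDiffAt_metric (IB := 𝓡 n) (k := 1)
    (F := EuclideanSpace ℝ (Fin n)) (E := fun x : M => TangentSpace (𝓡 n) x) x₀
  obtain ⟨B, hB, hBev⟩ := eventually_norm_trivializationAt_lt (EuclideanSpace ℝ (Fin n))
    (fun x : M => TangentSpace (𝓡 n) x) x₀
  set ψ := (extChartAt (𝓡 n) x₀).symm with hψ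
  have hψz : ψ z₀ = x₀ := extChartAt_to_inv (I := 𝓡 n) x₀
  have hG : ContDiffAt ℝ 1 (g ∘ ψ) z₀ := by
    rw [← contMDiffAt_iff_contDiffAt]
    exact ContMDiffAt.comp _ (by rw [hψz]; exact hg)
      ((contMDiffOn_extChartAt_symm x₀).contMDiffAt (extChartAt_target_mem_nhds x₀))
  obtain ⟨K, t, ht, hK⟩ := hG.exists_lipschitzOnWith
  have hcont : Tendsto ψ (𝓝 z₀) (𝓝 x₀) := by
    have : ContinuousAt ψ z₀ := continuousAt_extChartAt_symm _
    rwa [ContinuousAt, hψz] at this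
  obtain ⟨r, hr, hrs⟩ := Metric.nhds_basis_closedBall.mem_iff.1
    (inter_mem (inter_mem ht (extChartAt_target_mem_nhds (I := 𝓡 n) x₀)) (hcont.eventually hBev))
  have hsource : ∀ z ∈ Metric.closedBall z₀ r, ψ z ∈ (chartAt (EuclideanSpace ℝ (Fin n)) x₀).source :=
    fun z hz => by
      rw [← extChartAt_source (𝓡 n)]; exact (extChartAt (𝓡 n) x₀).map_target (hrs hz).1.2
  have hbase : ∀ z ∈ Metric.closedBall z₀ r, ψ z ∈ τ.baseSet := hsource
  have hfin : ∀ y : M, FiniteDimensional ℝ (TangentSpace (𝓡 n) y) := fun y =>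
    inferInstanceAs (FiniteDimensional ℝ (EuclideanSpace ℝ (Fin n)))
  have hdim : ∀ y : M, Module.finrank ℝ (TangentSpace (𝓡 n) y) = n := fun y =>
    finrank_euclideanSpace_fin (𝕜 := ℝ) (n := n)
  -- Each `A z` is determined only up to an isometry and need not depend continuously on `z`; only
  -- the norms `‖A z v‖` are used.
  choose A hA using fun z => exists_clm_norm_eq (hdim (ψ z)) (τ.symmL ℝ (ψ z))
  have lower : ∀ z ∈ Metric.closedBall z₀ r, ∀ v, ‖v‖ ≤ B * ‖A z v‖ := by
    intro z hz v
    rw [hA]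
    refine (Trivialization.norm_le_mul_norm_symmL x₀ (hbase z hz) v).trans ?_
    gcongr
    exact (hrs hz).2.le
  have hs : ∀ z ∈ Metric.closedBall z₀ r, ∀ v, ‖A z v‖ ^ 2 = g (ψ z) v v := fun z hz v => by
    rw [hA, hgn _ (hbase z hz)]
  refine ⟨r, K * B ^ 2, B⁻¹, A, hr, by positivity, by positivity,
    fun z hz => (hrs hz).1.2, fun z hz v => ?_,
    fun z hz v => (inv_mul_le_iff₀ hB).2 (lower z hz v), fun z hz z' hz' v => ?_⟩
  · have e := TangentBundle.symmL_trivializationAt (𝕜 := ℝ) (I := 𝓡 n) (hsource z hz)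
    rw [(extChartAt (𝓡 n) x₀).right_inv (hrs hz).1.2] at e
    exact (hA z v).trans (congrArg
      (fun D : EuclideanSpace ℝ (Fin n) →L[ℝ] TangentSpace (𝓡 n) (ψ z) => ‖D v‖) e)
  · have h2 := hK.dist_le_mul z (hrs hz).1.1 z' (hrs hz').1.1
    rw [dist_eq_norm z z'] at h2
    have := le_mul_of_norm_bilin_sub_le (norm_nonneg _) (by positivity) (hs z hz v) (hs z' hz' v)
      h2 (lower z' hz' v)
    rwa [mul_comm (K : ℝ), mul_assoc]

end Chart

/-! ### Comparison of Riemannian distance and chart displacement. -/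

section ChartLength

variable {n : ℕ} {M : Type*} [TopologicalSpace M] [ChartedSpace (EuclideanSpace ℝ (Fin n)) M]
  [RiemannianBundle (fun x : M => TangentSpace (𝓡 n) x)]

/-- All tangent spaces are the same vector space by definition, but their norms depend on the base
point; this allows the base point to be replaced by an equal one. -/
lemma norm_tangentSpace_congr {y y' : M} (h : y' = y) (v : EuclideanSpace ℝ (Fin n)) :
    ‖(show TangentSpace (𝓡 n) y' from v)‖ = ‖(show TangentSpace (𝓡 n) y from v)‖ := by
  subst h; rfl

namespace ChartNormBounds

variable {x₀ : M} {r C m : ℝ}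
  {A : EuclideanSpace ℝ (Fin n) → EuclideanSpace ℝ (Fin n) →L[ℝ] EuclideanSpace ℝ (Fin n)}

section

variable [IsManifold (𝓡 n) 1 M]

lemma norm_mfderiv_extChartAt (hA : ChartNormBounds x₀ r C m A) {y : M}
    (hy : y ∈ (extChartAt (𝓡 n) x₀).source)
    (hyr : extChartAt (𝓡 n) x₀ y ∈ Metric.closedBall (extChartAt (𝓡 n) x₀ x₀) r)
    (u : TangentSpace (𝓡 n) y) :
    ‖A (extChartAt (𝓡 n) x₀ y)
      (mfderiv (𝓡 n) 𝓘(ℝ, EuclideanSpace ℝ (Fin n)) (extChartAt (𝓡 n) x₀) y u)‖ = ‖u‖ := by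
  have h := congr($(mfderivWithin_extChartAt_symm_comp_mfderiv_extChartAt' (I := 𝓡 n) hy) u)
  refine (hA.norm_eq _ hyr _).trans ?_
  refine Eq.trans ?_ (norm_tangentSpace_congr ((extChartAt (𝓡 n) x₀).left_inv hy) u)
  exact congrArg (fun w : TangentSpace (𝓡 n)
    ((extChartAt (𝓡 n) x₀).symm (extChartAt (𝓡 n) x₀ y)) => ‖w‖) h

lemma norm_derivWithin_extChartAt_comp (hA : ChartNormBounds x₀ r C m A) {γ : ℝ → M} {s : Set ℝ}
    {t : ℝ} (hγ : MDifferentiableWithinAt 𝓘(ℝ, ℝ) (𝓡 n) γ s t) (hs : UniqueDiffWithinAt ℝ s t)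
    (ht : γ t ∈ (extChartAt (𝓡 n) x₀).source)
    (htr : extChartAt (𝓡 n) x₀ (γ t) ∈ Metric.closedBall (extChartAt (𝓡 n) x₀ x₀) r) :
    ‖A (extChartAt (𝓡 n) x₀ (γ t)) (derivWithin (extChartAt (𝓡 n) x₀ ∘ γ) s t)‖ =
      ‖mfderivWithin 𝓘(ℝ, ℝ) (𝓡 n) γ s t (1 : ℝ)‖ := by
  rw [← hA.norm_mfderiv_extChartAt ht htr]
  have h1 : mfderivWithin 𝓘(ℝ, ℝ) 𝓘(ℝ, EuclideanSpace ℝ (Fin n)) (extChartAt (𝓡 n) x₀ ∘ γ) s t =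
      (mfderiv (𝓡 n) 𝓘(ℝ, EuclideanSpace ℝ (Fin n)) (extChartAt (𝓡 n) x₀) (γ t)).comp
        (mfderivWithin 𝓘(ℝ, ℝ) (𝓡 n) γ s t) := by
    apply mfderiv_comp_mfderivWithin
    · exact mdifferentiableAt_extChartAt (by rwa [← extChartAt_source (𝓡 n)])
    · exact hγ
    · exact hs.uniqueMDiffWithinAt
  rw [mfderivWithin_eq_fderivWithin] at h1
  have h2 := congr($h1 (1 : ℝ))
  rw [fderivWithin_derivWithin] at h2
  exact congrArg (fun w => ‖A (extChartAt (𝓡 n) x₀ (γ t)) w‖) h2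

/-- The length of a curve in a chart domain bounds the displacement of its image under a linear
map that the Riemannian norm controls. -/
lemma enorm_sub_le_pathELength (hA : ChartNormBounds x₀ r C m A) {γ : ℝ → M} {a b c : ℝ}
    (hab : a ≤ b) (hc : 0 ≤ c) (hγ : ContMDiffOn 𝓘(ℝ, ℝ) (𝓡 n) 1 γ (Icc a b))
    (hs : ∀ t ∈ Icc a b, γ t ∈ (extChartAt (𝓡 n) x₀).source)
    (hr : ∀ t ∈ Icc a b, extChartAt (𝓡 n) x₀ (γ t) ∈
      Metric.closedBall (extChartAt (𝓡 n) x₀ x₀) r)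
    (L : EuclideanSpace ℝ (Fin n) →L[ℝ] EuclideanSpace ℝ (Fin n))
    (hL : ∀ t ∈ Icc a b, ∀ v, ‖L v‖ ≤ c * ‖A (extChartAt (𝓡 n) x₀ (γ t)) v‖) :
    ‖L (extChartAt (𝓡 n) x₀ (γ b) - extChartAt (𝓡 n) x₀ (γ a))‖ₑ ≤
      ENNReal.ofReal c * pathELength (𝓡 n) γ a b := by
  rcases hab.eq_or_lt with rfl | hlt
  · simp
  set η := extChartAt (𝓡 n) x₀ ∘ γ with hη
  have hηc : ContDiffOn ℝ 1 η (Icc a b) := by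
    rw [← contMDiffOn_iff_contDiffOn]
    exact contMDiffOn_extChartAt.comp (I' := 𝓡 n) (t := (chartAt _ x₀).source) hγ
      (fun t ht => by simpa using hs t ht)
  rw [map_sub]
  refine (enorm_sub_le_lintegral_derivWithin_Icc_of_contDiffOn_Icc (f := fun t => L (η t))
    (L.contDiff.comp_contDiffOn hηc) hab).trans ?_
  rw [pathELength_eq_lintegral_mfderivWithin_Icc, ← lintegral_const_mul' _ _ ENNReal.ofReal_ne_top]
  refine setLIntegral_mono' measurableSet_Icc fun t ht => ?_
  have hu := uniqueDiffOn_Icc hlt t ht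
  have hd := (hηc.differentiableOn one_ne_zero t ht).hasDerivWithinAt
  rw [show derivWithin (fun t => L (η t)) (Icc a b) t = L (derivWithin η (Icc a b) t) from
    (L.hasFDerivAt.comp_hasDerivWithinAt t hd).derivWithin hu, ← ofReal_norm, ← ofReal_norm,
    ← ENNReal.ofReal_mul hc]
  refine ENNReal.ofReal_le_ofReal ((hL t ht _).trans_eq (congrArg (c * ·) ?_))
  exact hA.norm_derivWithin_extChartAt_comp (hγ.mdifferentiableOn one_ne_zero t ht) hu (hs t ht)
    (hr t ht)

/-- A short curve that starts well inside a chart ball does not leave it. -/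
lemma norm_sub_le_of_pathELength_lt [T2Space M] (hA : ChartNormBounds x₀ r C m A) {γ : ℝ → M}
    {ℓ : ℝ} (hγ : ContMDiff 𝓘(ℝ, ℝ) (𝓡 n) 1 γ)
    (h0 : γ 0 ∈ (extChartAt (𝓡 n) x₀).source)
    (hℓ : pathELength (𝓡 n) γ 0 1 < ENNReal.ofReal ℓ)
    (h0r : ‖extChartAt (𝓡 n) x₀ (γ 0) - extChartAt (𝓡 n) x₀ x₀‖ + ℓ / m ≤ r) :
    ∀ t ∈ Icc (0 : ℝ) 1, γ t ∈ (extChartAt (𝓡 n) x₀).source ∧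
      ‖extChartAt (𝓡 n) x₀ (γ t) - extChartAt (𝓡 n) x₀ (γ 0)‖ < ℓ / m := by
  set φ := extChartAt (𝓡 n) x₀ with hφ
  have hℓ0 : 0 < ℓ := by
    by_contra h
    rw [ENNReal.ofReal_of_nonpos (not_lt.1 h)] at hℓ
    exact not_lt_bot hℓ
  have hm := hA.bound_pos
  set u : Set M := φ.symm '' Metric.closedBall (φ x₀) r with hu
  have hcont : ContinuousOn φ.symm (Metric.closedBall (φ x₀) r) :=
    (continuousOn_extChartAt_symm x₀).mono hA.subset_target
  have hucl : IsClosed u := ((isCompact_closedBall _ _).image_of_continuousOn hcont).isClosed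
  have hus : ∀ y ∈ u, y ∈ φ.source ∧ φ y ∈ Metric.closedBall (φ x₀) r := by
    rintro _ ⟨z, hz, rfl⟩
    refine ⟨φ.map_target (hA.subset_target hz), ?_⟩
    rwa [φ.right_inv (hA.subset_target hz)]
  have hmem : ∀ y ∈ φ.source, φ y ∈ Metric.closedBall (φ x₀) r → y ∈ u := fun y hy hyr =>
    ⟨φ y, hyr, φ.left_inv hy⟩
  have short : ∀ t ∈ Icc (0 : ℝ) 1, Icc 0 t ⊆ γ ⁻¹' u → ‖φ (γ t) - φ (γ 0)‖ < ℓ / m := by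
    intro t ht htu
    have h1 := hA.enorm_sub_le_pathELength (c := m⁻¹) ht.1 (by positivity) hγ.contMDiffOn
      (fun s hs => (hus _ (htu hs)).1) (fun s hs => (hus _ (htu hs)).2)
      (ContinuousLinearMap.id ℝ _) (fun s hs v => by
        rw [← div_eq_inv_mul, le_div_iff₀' hm]
        exact hA.le_norm _ (hus _ (htu hs)).2 v)
    have h2 : ‖φ (γ t) - φ (γ 0)‖ₑ < ENNReal.ofReal (ℓ / m) := by
      refine h1.trans_lt ?_
      rw [div_eq_inv_mul, ENNReal.ofReal_mul (by positivity)]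
      refine ENNReal.mul_lt_mul_right (ENNReal.ofReal_pos.2 (by positivity)).ne'
        ENNReal.ofReal_ne_top ((pathELength_mono le_rfl ht.2).trans_lt hℓ)
    rw [← ofReal_norm] at h2
    exact (ENNReal.ofReal_lt_ofReal_iff (by positivity)).1 h2
  have h00 : γ 0 ∈ u := hmem _ h0 (by
    rw [mem_closedBall_iff_norm]; linarith [div_pos hℓ0 hm])
  -- Continuous induction on time: `u` is closed, and as long as the curve has stayed in `u` the
  -- length bound keeps it in the open ball, so it stays in `u` a little longer.
  have hall : Icc (0 : ℝ) 1 ⊆ γ ⁻¹' u := by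
    refine ((hucl.preimage hγ.continuous).inter isClosed_Icc
      ).Icc_subset_of_forall_mem_nhdsGT_of_Icc_subset h00 fun t ht htu => ?_
    have hts := hus (γ t) (htu ⟨ht.1, le_rfl⟩)
    have htl := short t ⟨ht.1, ht.2.le⟩ htu
    have hball : φ (γ t) ∈ Metric.ball (φ x₀) r := by
      rw [mem_ball_iff_norm]
      linarith [norm_sub_le_norm_sub_add_norm_sub (φ (γ t)) (φ (γ 0)) (φ x₀)]
    have hn : u ∈ 𝓝 (γ t) := by
      have h1 : φ ⁻¹' Metric.ball (φ x₀) r ∈ 𝓝 (γ t) :=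
        (continuousAt_extChartAt' hts.1).preimage_mem_nhds (Metric.isOpen_ball.mem_nhds hball)
      filter_upwards [h1, extChartAt_source_mem_nhds' hts.1] with y hy hys
      exact hmem y hys (Metric.ball_subset_closedBall hy)
    exact mem_nhdsWithin_of_mem_nhds (hγ.continuous.continuousAt.preimage_mem_nhds hn)
  exact fun t ht => ⟨(hus _ (hall ht)).1, short t ht ((Icc_subset_Icc_right ht.2).trans hall)⟩

/-- The Riemannian distance bounds the displacement in a chart, with constants close to those of
the metric at any nearby point. -/
lemma norm_sub_le_of_riemannianEDist_lt [T2Space M] (hA : ChartNormBounds x₀ r C m A) {x y : M}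
    {ℓ ρ : ℝ} (hx : x ∈ (extChartAt (𝓡 n) x₀).source)
    (hℓ : riemannianEDist (𝓡 n) x y < ENNReal.ofReal ℓ)
    (hxr : ‖extChartAt (𝓡 n) x₀ x - extChartAt (𝓡 n) x₀ x₀‖ + ℓ / m ≤ r)
    {z : EuclideanSpace ℝ (Fin n)} (hz : z ∈ Metric.closedBall (extChartAt (𝓡 n) x₀ x₀) r)
    (hzx : ‖z - extChartAt (𝓡 n) x₀ x‖ ≤ ρ) :
    y ∈ (extChartAt (𝓡 n) x₀).source ∧
    ‖extChartAt (𝓡 n) x₀ y - extChartAt (𝓡 n) x₀ x‖ ≤ ℓ / m ∧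
    ‖A z (extChartAt (𝓡 n) x₀ y - extChartAt (𝓡 n) x₀ x)‖ ≤ (1 + C * (ρ + ℓ / m)) * ℓ := by
  obtain ⟨γ, rfl, rfl, hγ, hγℓ, -⟩ := exists_lt_locally_constant_of_riemannianEDist_lt hℓ zero_lt_one
  have hin := hA.norm_sub_le_of_pathELength_lt hγ hx hγℓ hxr
  have hm := hA.bound_pos
  have hC := hA.const_nonneg
  set φ := extChartAt (𝓡 n) x₀ with hφ
  have h1 : (1 : ℝ) ∈ Icc (0 : ℝ) 1 := ⟨zero_le_one, le_rfl⟩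
  have hℓm : 0 ≤ ℓ / m := (norm_nonneg _).trans (hin 1 h1).2.le
  have hℓ0 : 0 ≤ ℓ := by rwa [le_div_iff₀ hm, zero_mul] at hℓm
  have hρ : 0 ≤ ρ := (norm_nonneg _).trans hzx
  have hball : ∀ t ∈ Icc (0 : ℝ) 1, φ (γ t) ∈ Metric.closedBall (φ x₀) r := fun t ht => by
    rw [mem_closedBall_iff_norm]
    linarith [norm_sub_le_norm_sub_add_norm_sub (φ (γ t)) (φ (γ 0)) (φ x₀), (hin t ht).2]
  refine ⟨(hin 1 h1).1, (hin 1 h1).2.le, ?_⟩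
  have key := hA.enorm_sub_le_pathELength (c := 1 + C * (ρ + ℓ / m)) zero_le_one (by positivity)
    hγ.contMDiffOn (fun t ht => (hin t ht).1) hball (A z) (fun t ht v => by
      refine (hA.norm_le z hz _ (hball t ht) v).trans ?_
      gcongr
      have := norm_sub_le_norm_sub_add_norm_sub z (φ (γ 0)) (φ (γ t))
      rw [norm_sub_rev (φ (γ 0))] at this
      linarith [(hin t ht).2])
  have h2 : ‖A z (φ (γ 1) - φ (γ 0))‖ₑ ≤ ENNReal.ofReal ((1 + C * (ρ + ℓ / m)) * ℓ) := by
    rw [ENNReal.ofReal_mul (by positivity)]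
    exact key.trans (by gcongr)
  rw [← ofReal_norm] at h2
  exact (ENNReal.ofReal_le_ofReal_iff (by positivity)).1 h2

/-- The Riemannian distance is bounded by the displacement in a chart, with constants close to
those of the metric at any nearby point. -/
lemma riemannianEDist_le (hA : ChartNormBounds x₀ r C m A) {z₁ z₂ z : EuclideanSpace ℝ (Fin n)}
    {ρ : ℝ} (hz₁ : z₁ ∈ Metric.closedBall (extChartAt (𝓡 n) x₀ x₀) r)
    (hz₂ : z₂ ∈ Metric.closedBall (extChartAt (𝓡 n) x₀ x₀) r)
    (hz : z ∈ Metric.closedBall (extChartAt (𝓡 n) x₀ x₀) r)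
    (h₁ : z₁ ∈ Metric.closedBall z ρ) (h₂ : z₂ ∈ Metric.closedBall z ρ) :
    riemannianEDist (𝓡 n) ((extChartAt (𝓡 n) x₀).symm z₁) ((extChartAt (𝓡 n) x₀).symm z₂) ≤
      ENNReal.ofReal ((1 + C * ρ) * ‖A z (z₂ - z₁)‖) := by
  set φ := extChartAt (𝓡 n) x₀ with hφ
  -- The competitor is the straight chord in the chart, which stays in both balls by convexity.
  set η : ℝ → EuclideanSpace ℝ (Fin n) := fun t => z₁ + t • (z₂ - z₁) with hη
  have hηseg : ∀ t ∈ Icc (0 : ℝ) 1, η t ∈ segment ℝ z₁ z₂ := fun t ht => by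
    rw [segment_eq_image']; exact ⟨t, ht, rfl⟩
  have hηr : ∀ t ∈ Icc (0 : ℝ) 1, η t ∈ Metric.closedBall (φ x₀) r := fun t ht =>
    (convex_closedBall _ _).segment_subset hz₁ hz₂ (hηseg t ht)
  have hηρ : ∀ t ∈ Icc (0 : ℝ) 1, η t ∈ Metric.closedBall z ρ := fun t ht =>
    (convex_closedBall _ _).segment_subset h₁ h₂ (hηseg t ht)
  have hηd : ∀ t, HasDerivAt η (z₂ - z₁) t := fun t => by
    have h := ((hasDerivAt_id t).smul_const (z₂ - z₁)).const_add z₁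
    rw [one_smul] at h
    exact h
  have hηc : ContDiff ℝ 1 η := by fun_prop
  have hγ : ContMDiffOn 𝓘(ℝ, ℝ) (𝓡 n) 1 (φ.symm ∘ η) (Icc 0 1) :=
    (contMDiffOn_extChartAt_symm x₀).comp hηc.contMDiff.contMDiffOn
      fun t ht => hA.subset_target (hηr t ht)
  have hle := riemannianEDist_le_pathELength (x := φ.symm z₁) (y := φ.symm z₂) hγ
    (by simp [hη]) (by simp [hη]) zero_le_one
  refine hle.trans ?_
  rw [pathELength_eq_lintegral_mfderivWithin_Icc]
  have hconst : ENNReal.ofReal ((1 + C * ρ) * ‖A z (z₂ - z₁)‖) =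
      ∫⁻ _ in Icc (0 : ℝ) 1, ENNReal.ofReal ((1 + C * ρ) * ‖A z (z₂ - z₁)‖) := by simp
  rw [hconst]
  refine setLIntegral_mono' measurableSet_Icc fun t ht => ?_
  have hu := uniqueDiffOn_Icc (zero_lt_one (α := ℝ)) t ht
  have hφη : ∀ s ∈ Icc (0 : ℝ) 1, (φ ∘ φ.symm ∘ η) s = η s := fun s hs =>
    φ.right_inv (hA.subset_target (hηr s hs))
  have hspeed := hA.norm_derivWithin_extChartAt_comp
    (hγ.mdifferentiableOn one_ne_zero t ht) hu (φ.map_target (hA.subset_target (hηr t ht)))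
    (by have := hφη t ht; simp only [Function.comp_apply] at this ⊢; rw [this]; exact hηr t ht)
  rw [← ofReal_norm]
  refine ENNReal.ofReal_le_ofReal (hspeed.ge.trans ?_)
  rw [derivWithin_congr hφη (hφη t ht), (hηd t).hasDerivWithinAt.derivWithin hu]
  have e : φ ((φ.symm ∘ η) t) = η t := hφη t ht
  rw [e]
  refine (hA.norm_le _ (hηr t ht) z hz _).trans ?_
  have hC := hA.const_nonneg
  have := hηρ t ht
  rw [mem_closedBall_iff_norm] at this
  gcongr

end

end ChartNormBounds

end ChartLength

/-- A quantitative parallelogram law: two nearly aligned vectors of nearly equal length `h` are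
nearly equal. -/
lemma norm_sub_le_of_le_norm_add {V : Type*} [NormedAddCommGroup V] [InnerProductSpace ℝ V]
    {u v : V} {h κ l : ℝ} (hh : 0 ≤ h) (hκ : 0 ≤ κ) (hl : h ≤ l)
    (hu : ‖u‖ ≤ (1 + κ * h) * h) (hv : ‖v‖ ≤ (1 + κ * h) * h)
    (huv : 2 * h ≤ (1 + κ * h) * ‖u + v‖) :
    ‖u - v‖ ≤ √(4 * (4 * κ + κ ^ 2 * l)) * (h * √h) := by
  set x := κ * h with hx
  have hx0 : 0 ≤ x := by positivity
  have h1 : ‖u‖ ^ 2 ≤ ((1 + x) * h) ^ 2 := by gcongr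
  have h2 : ‖v‖ ^ 2 ≤ ((1 + x) * h) ^ 2 := by gcongr
  -- Since `(1 - 2 * x) * (1 + x) ^ 2 ≤ 1`, the factor `1 - 2 * x` bounds `1 / (1 + x) ^ 2` from
  -- below and avoids a division.
  have h3 : 4 * h ^ 2 * (1 - 2 * x) ≤ ‖u + v‖ ^ 2 := by
    have h4 : (2 * h) ^ 2 ≤ ((1 + x) * ‖u + v‖) ^ 2 := by gcongr
    have h5 : (1 - 2 * x) * (1 + x) ^ 2 ≤ 1 := by nlinarith [mul_nonneg hx0 (sq_nonneg x)]
    have h6 : 4 * h ^ 2 * ((1 - 2 * x) * (1 + x) ^ 2) ≤ 4 * h ^ 2 * 1 := by gcongr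
    have h7 : 0 < (1 + x) ^ 2 := by positivity
    refine le_of_mul_le_mul_right ?_ h7
    nlinarith
  have h8 : ‖u - v‖ ^ 2 ≤ 4 * (4 * κ + κ ^ 2 * l) * h ^ 3 := by
    have := parallelogram_law_with_norm ℝ u v
    have h9 : κ ^ 2 * h * h ^ 3 ≤ κ ^ 2 * l * h ^ 3 := by gcongr
    have e : 2 * (2 * ((1 + x) * h) ^ 2) - 4 * h ^ 2 * (1 - 2 * x) =
      16 * κ * h ^ 3 + 4 * (κ ^ 2 * h * h ^ 3) := by rw [hx]; ring
    nlinarith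
  have h10 : (√(4 * (4 * κ + κ ^ 2 * l)) * (h * √h)) ^ 2 = 4 * (4 * κ + κ ^ 2 * l) * h ^ 3 := by
    have : 0 ≤ l := hh.trans hl
    rw [mul_pow, mul_pow, Real.sq_sqrt (by positivity), Real.sq_sqrt hh]; ring
  exact le_of_sq_le_sq (h8.trans_eq h10.symm) (by positivity)

/-! ### Minimizing segments are `C^1` unit speed geodesics. -/

section Segment

variable {n : ℕ} {M : Type*} [TopologicalSpace M] [ChartedSpace (EuclideanSpace ℝ (Fin n)) M]
  [RiemannianBundle (fun x : M => TangentSpace (𝓡 n) x)]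

/-- `c` is a minimizing segment on `[a, b]`, parametrized by arc length. -/
structure IsSegment (n : ℕ) {M : Type*} [TopologicalSpace M]
    [ChartedSpace (EuclideanSpace ℝ (Fin n)) M]
    [RiemannianBundle (fun x : M => TangentSpace (𝓡 n) x)] (c : ℝ → M) (a b : ℝ) : Prop where
  continuousOn : ContinuousOn c (Icc a b)
  edist_eq : ∀ s ∈ Icc a b, ∀ t ∈ Icc a b,
    riemannianEDist (𝓡 n) (c s) (c t) = ENNReal.ofReal |s - t|

lemma IsSegment.mono {c : ℝ → M} {a b a' b' : ℝ} (hc : IsSegment n c a b)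
    (h : Icc a' b' ⊆ Icc a b) : IsSegment n c a' b' :=
  ⟨hc.continuousOn.mono h, fun s hs t ht => hc.edist_eq s (h hs) t (h ht)⟩

lemma IsSegment.exists_mem_nhdsWithin {c : ℝ → M} {a b : ℝ} (hc : IsSegment n c a b) {t : ℝ} (ht : t ∈ Icc a b)
    {r : ℝ} (hr : 0 < r) : ∃ δ > 0, ∀ s ∈ Icc a b, |s - t| ≤ δ →
      c s ∈ (extChartAt (𝓡 n) (c t)).source ∧
      ‖extChartAt (𝓡 n) (c t) (c s) - extChartAt (𝓡 n) (c t) (c t)‖ < r := by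
  have h1 : Tendsto c (𝓝[Icc a b] t) (𝓝 (c t)) := hc.continuousOn t ht
  have h2 := h1.eventually (extChartAt_source_mem_nhds (I := 𝓡 n) (c t))
  have h3 := h1.eventually ((continuousAt_extChartAt (I := 𝓡 n) (c t)).eventually
    (Metric.ball_mem_nhds _ hr))
  obtain ⟨δ, hδ, h⟩ := Metric.mem_nhdsWithin_iff.1 (h2.and h3)
  refine ⟨δ / 2, by positivity, fun s hs hst => ?_⟩
  have := h ⟨by rw [Metric.mem_ball, Real.dist_eq]; linarith, hs⟩
  exact ⟨this.1, by rw [← mem_ball_iff_norm]; exact this.2⟩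

variable [IsManifold (𝓡 n) 1 M] [T2Space M]

namespace ChartNormBounds

variable {x₀ : M} {r C m : ℝ}
  {A : EuclideanSpace ℝ (Fin n) → EuclideanSpace ℝ (Fin n) →L[ℝ] EuclideanSpace ℝ (Fin n)}

/-- Limit `ℓ → d` from above of the estimate for distances less than `ℓ`, since a minimizing curve
need not be available. -/
lemma norm_sub_le_of_riemannianEDist_eq (hA : ChartNormBounds x₀ r C m A) {x y : M}
    {d ρ : ℝ} (hx : x ∈ (extChartAt (𝓡 n) x₀).source) (hd : 0 ≤ d)
    (hxy : riemannianEDist (𝓡 n) x y = ENNReal.ofReal d)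
    (hxr : ‖extChartAt (𝓡 n) x₀ x - extChartAt (𝓡 n) x₀ x₀‖ + d / m < r)
    {z : EuclideanSpace ℝ (Fin n)} (hz : z ∈ Metric.closedBall (extChartAt (𝓡 n) x₀ x₀) r)
    (hzx : ‖z - extChartAt (𝓡 n) x₀ x‖ ≤ ρ) :
    ‖extChartAt (𝓡 n) x₀ y - extChartAt (𝓡 n) x₀ x‖ ≤ d / m ∧
    ‖A z (extChartAt (𝓡 n) x₀ y - extChartAt (𝓡 n) x₀ x)‖ ≤ (1 + C * (ρ + d / m)) * d := by
  have hev : ∀ᶠ ℓ in 𝓝[>] d, ‖extChartAt (𝓡 n) x₀ y - extChartAt (𝓡 n) x₀ x‖ ≤ ℓ / m ∧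
      ‖A z (extChartAt (𝓡 n) x₀ y - extChartAt (𝓡 n) x₀ x)‖ ≤ (1 + C * (ρ + ℓ / m)) * ℓ := by
    have h1 : ∀ᶠ ℓ in 𝓝[>] d,
        ‖extChartAt (𝓡 n) x₀ x - extChartAt (𝓡 n) x₀ x₀‖ + ℓ / m < r := by
      have : ContinuousAt (fun ℓ : ℝ =>
        ‖extChartAt (𝓡 n) x₀ x - extChartAt (𝓡 n) x₀ x₀‖ + ℓ / m) d := by fun_prop
      exact nhdsWithin_le_nhds (this.eventually (gt_mem_nhds hxr))
    filter_upwards [h1, self_mem_nhdsWithin] with ℓ hℓ hdℓ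
    refine (hA.norm_sub_le_of_riemannianEDist_lt hx ?_ hℓ.le hz hzx).2
    rw [hxy]
    exact (ENNReal.ofReal_lt_ofReal_iff (hd.trans_lt hdℓ)).2 hdℓ
  constructor
  · have : Tendsto (fun ℓ : ℝ => ℓ / m) (𝓝[>] d) (𝓝 (d / m)) :=
      tendsto_nhdsWithin_of_tendsto_nhds (by apply Continuous.tendsto; fun_prop)
    exact ge_of_tendsto this (hev.mono fun _ h => h.1)
  · have : Tendsto (fun ℓ : ℝ => (1 + C * (ρ + ℓ / m)) * ℓ) (𝓝[>] d)
        (𝓝 ((1 + C * (ρ + d / m)) * d)) :=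
      tendsto_nhdsWithin_of_tendsto_nhds
        ((by fun_prop : Continuous fun ℓ : ℝ => (1 + C * (ρ + ℓ / m)) * ℓ).tendsto d)
    exact ge_of_tendsto this (hev.mono fun _ h => h.2)

/-- A minimizing segment inside a chart ball is `C^1` in the chart. -/
lemma contDiffOn_extChartAt_comp_of_isSegment (hA : ChartNormBounds x₀ r C m A) {c : ℝ → M}
    {a b : ℝ} (hab : a < b) (hc : IsSegment n c a b)
    (hs : ∀ t ∈ Icc a b, c t ∈ (extChartAt (𝓡 n) x₀).source)
    (hr : ∀ t ∈ Icc a b,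
      ‖extChartAt (𝓡 n) x₀ (c t) - extChartAt (𝓡 n) x₀ x₀‖ + (b - a) / m < r) :
    ContDiffOn ℝ 1 (extChartAt (𝓡 n) x₀ ∘ c) (Icc a b) := by
  set φ := extChartAt (𝓡 n) x₀ with hφ
  have hm := hA.bound_pos
  have hC := hA.const_nonneg
  have hball : ∀ t ∈ Icc a b, φ (c t) ∈ Metric.closedBall (φ x₀) r := fun t ht => by
    rw [mem_closedBall_iff_norm]
    have : 0 < (b - a) / m := div_pos (sub_pos.2 hab) hm
    linarith [hr t ht]
  have hcont : ContinuousOn (φ ∘ c) (Icc a b) :=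
    (continuousOn_extChartAt x₀).comp hc.continuousOn hs
  refine contDiffOn_of_secondDifference_le
    (C := m⁻¹ * √(4 * (4 * (C / m) + (C / m) ^ 2 * (b - a)))) hab hcont
    fun t h hh h1 h2 => ?_
  have ht : t ∈ Icc a b := ⟨by linarith [h1.1], by linarith [h2.2]⟩
  have hhb : h ≤ b - a := by linarith [h1.1, h2.2]
  have hrt : ‖φ (c t) - φ x₀‖ + h / m < r := by
    refine lt_of_le_of_lt ?_ (hr t ht)
    gcongr
  have hp := hA.norm_sub_le_of_riemannianEDist_eq (y := c (t + h)) (d := h) (ρ := 0) (hs t ht) hh.le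
    (by rw [hc.edist_eq t ht _ h2]; congr 1; rw [sub_add_cancel_left, abs_neg, abs_of_pos hh])
    hrt (hball t ht) (by rw [← hφ, sub_self, norm_zero])
  have hq := hA.norm_sub_le_of_riemannianEDist_eq (y := c (t - h)) (d := h) (ρ := 0) (hs t ht) hh.le
    (by rw [hc.edist_eq t ht _ h1]; congr 1; rw [sub_sub_cancel, abs_of_pos hh])
    hrt (hball t ht) (by rw [← hφ, sub_self, norm_zero])
  rw [← hφ] at hp hq
  -- The metric is frozen at the midpoint `c t`: both half displacements have norm at most `(1 +
  -- O(h)) * h`, while minimality bounds the norm of their sum below by `2 * h / (1 + O(h))`.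
  have hd := hA.riemannianEDist_le (ρ := h / m) (hball _ h1) (hball _ h2) (hball t ht)
    (mem_closedBall_iff_norm.2 hq.1) (mem_closedBall_iff_norm.2 hp.1)
  rw [φ.left_inv (hs _ h1), φ.left_inv (hs _ h2), hc.edist_eq _ h1 _ h2,
    ENNReal.ofReal_le_ofReal_iff (by positivity),
    show t - h - (t + h) = -(2 * h) by ring, abs_neg, abs_of_pos (by positivity)] at hd
  set u := φ (c (t + h)) - φ (c t) with hu
  set v := φ (c t) - φ (c (t - h)) with hv
  have huv : φ (c (t + h)) - φ (c (t - h)) = u + v := by rw [hu, hv]; abel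
  have hvn : φ (c (t - h)) - φ (c t) = -v := by rw [hv]; abel
  rw [huv, map_add] at hd
  have hp2 := hp.2
  have hq2 := hq.2
  rw [hvn, map_neg, norm_neg] at hq2
  have e : C * (h / m) = C / m * h := by ring
  rw [zero_add, e] at hp2 hq2
  rw [e] at hd
  have key := norm_sub_le_of_le_norm_add hh.le (div_nonneg hC hm.le) hhb hp2 hq2 hd
  rw [← map_sub] at key
  have hfin := (hA.le_norm _ (hball t ht) _).trans key
  have hgoal : (φ ∘ c) (t + h) - (2 : ℝ) • (φ ∘ c) t + (φ ∘ c) (t - h) = u - v := by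
    rw [hu, hv, two_smul]; simp only [Function.comp_apply]; abel
  rw [hgoal, mul_assoc, ← div_eq_inv_mul, le_div_iff₀' hm]
  exact hfin

end ChartNormBounds

variable [IsManifold (𝓡 n) 2 M]
  [IsContMDiffRiemannianBundle (𝓡 n) 1 (EuclideanSpace ℝ (Fin n))
    (fun x : M => TangentSpace (𝓡 n) x)] {c : ℝ → M} {a b : ℝ}

/-- Minimizing segments of a `C^1` Riemannian metric are `C^1`. -/
lemma IsSegment.contMDiffOn (hab : a < b) (hc : IsSegment n c a b) :
    ContMDiffOn 𝓘(ℝ, ℝ) (𝓡 n) 1 c (Icc a b) := by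
  intro t ht
  obtain ⟨r, C, m, A, hA⟩ := exists_chartNormBounds (n := n) (c t)
  have hr := hA.radius_pos
  have hm := hA.bound_pos
  obtain ⟨δ₁, hδ₁, hδ⟩ := hc.exists_mem_nhdsWithin ht (half_pos hr)
  -- An interval of length at most `2 * δ ≤ m * r / 4` costs at most `r / 4` in the chart, leaving
  -- room beside the displacement below `r / 2`.
  set δ := min δ₁ (m * r / 8) with hδdef
  have hδ0 : 0 < δ := lt_min hδ₁ (by positivity)
  have hJ : Icc (max a (t - δ)) (min b (t + δ)) ⊆ Icc a b :=
    Icc_subset_Icc (le_max_left _ _) (min_le_left _ _)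
  have hJδ : ∀ s ∈ Icc (max a (t - δ)) (min b (t + δ)), |s - t| ≤ δ₁ := fun s hs => by
    refine le_trans (b := δ) (abs_le.2 ⟨?_, ?_⟩) (min_le_left _ _)
    · linarith [(le_max_right _ _).trans hs.1]
    · linarith [hs.2.trans (min_le_right _ _)]
  have hlt : max a (t - δ) < min b (t + δ) := by
    rw [max_lt_iff, lt_min_iff, lt_min_iff]
    exact ⟨⟨hab, by linarith [ht.1]⟩, by linarith [ht.2], by linarith⟩
  have hlen : (min b (t + δ) - max a (t - δ)) / m < r / 2 := by
    rw [div_lt_iff₀ hm]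
    have h1 : min b (t + δ) - max a (t - δ) ≤ 2 * δ := by
      linarith [min_le_right b (t + δ), le_max_right a (t - δ)]
    have h2 : δ ≤ m * r / 8 := min_le_right _ _
    nlinarith [mul_pos hm hr]
  have key := hA.contDiffOn_extChartAt_comp_of_isSegment hlt (hc.mono hJ)
    (fun s hs => (hδ s (hJ hs) (hJδ s hs)).1)
    (fun s hs => by linarith [(hδ s (hJ hs) (hJδ s hs)).2])
  have htJ : t ∈ Icc (max a (t - δ)) (min b (t + δ)) :=
    ⟨max_le ht.1 (by linarith), le_min ht.2 (by linarith)⟩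
  rw [contMDiffWithinAt_iff_target]
  refine ⟨hc.continuousOn t ht, ContDiffWithinAt.contMDiffWithinAt ?_⟩
  refine (key t htJ).mono_of_mem_nhdsWithin ?_
  have h1 : Icc (t - δ) (t + δ) ∈ 𝓝 t := Icc_mem_nhds (by linarith) (by linarith)
  filter_upwards [self_mem_nhdsWithin, mem_nhdsWithin_of_mem_nhds h1] with s hs hs'
  exact ⟨max_le hs.1 hs'.1, le_min hs.2 hs'.2⟩

/-- Distances along the segment equal parameter differences, and the metric frozen at `c t` matches
distances up to `1 + O(|s - t|)`; so the norms of the slopes tend to `1`. -/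
lemma IsSegment.norm_velocity (hab : a < b) (hc : IsSegment n c a b) {t : ℝ} (ht : t ∈ Icc a b) :
    ‖velocity (n := n) c a b t‖ = 1 := by
  obtain ⟨r, C, m, A, hA⟩ := exists_chartNormBounds (n := n) (c t)
  have hr := hA.radius_pos
  have hm := hA.bound_pos
  have hC := hA.const_nonneg
  have hu := uniqueDiffOn_Icc hab t ht
  set φ := extChartAt (𝓡 n) (c t) with hφ
  have hct := hc.contMDiffOn hab t ht
  have hz : φ (c t) ∈ Metric.closedBall (φ (c t)) r := Metric.mem_closedBall_self hr.le
  rw [velocity, ← hA.norm_derivWithin_extChartAt_comp (hct.mdifferentiableWithinAt one_ne_zero) hu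
    (mem_extChartAt_source (c t)) hz, ← hφ]
  have hder : HasDerivWithinAt (φ ∘ c) (derivWithin (φ ∘ c) (Icc a b) t) (Icc a b) t := by
    have h := (contMDiffWithinAt_iff_target.1 hct).2
    exact (h.contDiffWithinAt.differentiableWithinAt one_ne_zero).hasDerivWithinAt
  rw [hasDerivWithinAt_iff_tendsto_slope] at hder
  have hlim := ((A (φ (c t))).continuous.norm.tendsto _).comp hder
  have hne : (𝓝[Icc a b \ {t}] t).NeBot := by
    have := hu.accPt
    rwa [accPt_principal_iff_nhdsWithin] at this
  obtain ⟨δ₁, hδ₁, hδ⟩ := hc.exists_mem_nhdsWithin ht hr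
  have hbounds : ∀ᶠ s in 𝓝[Icc a b \ {t}] t,
      ‖A (φ (c t)) (slope (φ ∘ c) t s)‖ ≤ 1 + C * (|s - t| / m) ∧
      1 ≤ (1 + C * (|s - t| / m)) * ‖A (φ (c t)) (slope (φ ∘ c) t s)‖ := by
    have h1 : ∀ᶠ s in 𝓝[Icc a b \ {t}] t, |s - t| < min δ₁ (m * r) := by
      refine nhdsWithin_le_nhds (Metric.ball_mem_nhds t (ε := min δ₁ (m * r)) ?_)
      exact lt_min hδ₁ (by positivity)
    filter_upwards [h1, self_mem_nhdsWithin] with s hst hs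
    have hpos : 0 < |s - t| := abs_pos.2 (sub_ne_zero.2 hs.2)
    have hs1 := hδ s hs.1 (hst.le.trans (min_le_left _ _))
    have e := hA.norm_sub_le_of_riemannianEDist_eq (y := c s) (ρ := 0) (mem_extChartAt_source (c t))
      hpos.le (by rw [hc.edist_eq t ht s hs.1, abs_sub_comm])
      (by rw [sub_self, norm_zero, zero_add, div_lt_iff₀' hm]
          exact hst.trans_le (min_le_right _ _)) hz (by rw [← hφ, sub_self, norm_zero])
    rw [← hφ, zero_add] at e
    have hsr : φ (c s) ∈ Metric.closedBall (φ (c t)) r := mem_closedBall_iff_norm.2 hs1.2.le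
    have g := hA.riemannianEDist_le (ρ := |s - t| / m) hz hsr hz
      (Metric.mem_closedBall_self (by positivity)) (mem_closedBall_iff_norm.2 e.1)
    rw [φ.left_inv hs1.1, φ.left_inv (mem_extChartAt_source (c t)), hc.edist_eq t ht s hs.1,
      ENNReal.ofReal_le_ofReal_iff (by positivity), abs_sub_comm] at g
    have hsl : ‖A (φ (c t)) (slope (φ ∘ c) t s)‖ =
        ‖A (φ (c t)) (φ (c s) - φ (c t))‖ / |s - t| := by
      rw [slope_def_module, map_smul, norm_smul, norm_inv, Real.norm_eq_abs, ← div_eq_inv_mul]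
      rfl
    rw [hsl]
    constructor
    · rw [div_le_iff₀ hpos]; exact e.2
    · rw [← mul_div_assoc, le_div_iff₀ hpos, one_mul]; exact g
  have hone : Tendsto (fun s => 1 + C * (|s - t| / m)) (𝓝[Icc a b \ {t}] t) (𝓝 1) := by
    have h : Continuous fun s : ℝ => 1 + C * (|s - t| / m) := by fun_prop
    have := h.tendsto t
    simp only [sub_self, abs_zero, zero_div, mul_zero, add_zero] at this
    exact tendsto_nhdsWithin_of_tendsto_nhds this
  refine le_antisymm (le_of_tendsto_of_tendsto hlim hone (hbounds.mono fun _ h => h.1)) ?_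
  have := hone.mul hlim
  rw [one_mul] at this
  exact ge_of_tendsto this (hbounds.mono fun _ h => h.2)

lemma IsSegment.pathELength_eq (hab : a < b) (hc : IsSegment n c a b) {s t : ℝ}
    (hs : s ∈ Icc a b) (ht : t ∈ Icc a b) :
    pathELength (𝓡 n) c s t = ENNReal.ofReal (t - s) := by
  rw [pathELength_eq_lintegral_mfderiv_Ioo]
  have : ∀ u ∈ Ioo s t, ‖mfderiv 𝓘(ℝ, ℝ) (𝓡 n) c u (1 : ℝ)‖ₑ = 1 := by
    intro u hu
    have hua : Icc a b ∈ 𝓝 u := Icc_mem_nhds (hs.1.trans_lt hu.1) (hu.2.trans_le ht.2)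
    have h1 := hc.norm_velocity hab (mem_of_mem_nhds hua)
    rw [velocity, mfderivWithin_of_mem_nhds hua] at h1
    rw [← ofReal_norm]
    exact (congrArg ENNReal.ofReal h1).trans ENNReal.ofReal_one
  refine (setLIntegral_congr_fun measurableSet_Ioo this).trans ?_
  simp

/-- A minimizing segment parametrized by arc length is a geodesic with unitary affine
parametrization. -/
lemma IsSegment.isUnitGeodesic (hab : a < b) (hc : IsSegment n c a b) : IsUnitGeodesic n c a b where
  contMDiffOn := hc.contMDiffOn hab
  unit_speed t ht := by
    rw [real_inner_self_eq_norm_sq, hc.norm_velocity hab ht, one_pow]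
  minimal := by
    rw [hc.pathELength_eq hab (left_mem_Icc.2 hab.le) (right_mem_Icc.2 hab.le),
      hc.edist_eq a (left_mem_Icc.2 hab.le) b (right_mem_Icc.2 hab.le), abs_sub_comm,
      abs_of_pos (sub_pos.2 hab)]

end Segment

/-- The points at finite distance from `x` form a nonempty clopen set. -/
lemma edist_ne_top_of_preconnectedSpace {X : Type*} [PseudoEMetricSpace X] [PreconnectedSpace X]
    (x y : X) : edist x y ≠ ⊤ := by
  have h : IsClopen (Metric.eball x ⊤) := ⟨Metric.isClosed_eball_top, Metric.isOpen_eball⟩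
  have h' := h.eq_univ ⟨x, Metric.mem_eball_self ENNReal.zero_lt_top⟩
  have hy : y ∈ Metric.eball x ⊤ := h' ▸ mem_univ y
  rw [Metric.mem_eball'] at hy
  exact hy.ne

/-! ### The potential along a segment from a stationary point. -/

section Potential

variable {n : ℕ} {M : Type*} [TopologicalSpace M] [ChartedSpace (EuclideanSpace ℝ (Fin n)) M]
  [RiemannianBundle (fun x : M => TangentSpace (𝓡 n) x)]

/-- Absolute continuity of the integral of the speed; it serves to reparametrize curves by length.
-/
lemma continuousOn_pathELength_toReal {γ : ℝ → M} {a b : ℝ}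
    (h : pathELength (𝓡 n) γ a b ≠ ⊤) :
    ContinuousOn (fun u => (pathELength (𝓡 n) γ a u).toReal) (Icc a b) := by
  have hfin : ∀ u ∈ Icc a b, ∀ v ∈ Icc a b, pathELength (𝓡 n) γ u v ≠ ⊤ := fun u hu v hv =>
    ne_top_of_le_ne_top h (pathELength_mono hu.1 hv.2)
  rw [Metric.continuousOn_iff]
  intro t ht ε hε
  have h' := h
  rw [pathELength_eq_lintegral_mfderiv_Icc] at h'
  obtain ⟨δ, hδ, hδε⟩ := exists_pos_setLIntegral_lt_of_measure_lt h'
    (ENNReal.ofReal_pos.2 hε).ne'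
  have key : ∀ u ∈ Icc a b, ∀ v ∈ Icc a b, u ≤ v → ENNReal.ofReal (v - u) < δ →
      dist (pathELength (𝓡 n) γ a v).toReal (pathELength (𝓡 n) γ a u).toReal < ε := by
    intro u hu v hv huv hd
    have ha : a ∈ Icc a b := ⟨le_rfl, hu.1.trans hu.2⟩
    rw [← pathELength_add hu.1 huv, ENNReal.toReal_add (hfin a ha u hu) (hfin u hu v hv),
      Real.dist_eq, add_sub_cancel_left, abs_of_nonneg ENNReal.toReal_nonneg]
    refine (ENNReal.toReal_lt_toReal (hfin u hu v hv) ENNReal.ofReal_ne_top).2 ?_ |>.trans_eq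
      (ENNReal.toReal_ofReal hε.le)
    have := hδε (Icc u v) (lt_of_le_of_lt (Measure.restrict_apply_le _ _) (by simpa using hd))
    rwa [Measure.restrict_restrict measurableSet_Icc,
      inter_eq_self_of_subset_left (Icc_subset_Icc hu.1 hv.2),
      ← pathELength_eq_lintegral_mfderiv_Icc] at this
  obtain ⟨η, hη, hηδ⟩ : ∃ η > 0, ENNReal.ofReal η ≤ δ := by
    rcases eq_or_ne δ ⊤ with rfl | hne
    · exact ⟨1, one_pos, le_top⟩
    · exact ⟨δ.toReal, ENNReal.toReal_pos hδ.ne' hne, (ENNReal.ofReal_toReal hne).le⟩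
  refine ⟨η, hη, fun s hs hst => ?_⟩
  rw [Real.dist_eq] at hst
  have hlt : ∀ w, w ≤ |s - t| → ENNReal.ofReal w < δ := fun w hw =>
    ((ENNReal.ofReal_lt_ofReal_iff hη).2 (hw.trans_lt hst)).trans_le hηδ
  rcases le_total t s with h1 | h1
  · exact key t ht s hs h1 (hlt _ (le_abs_self _))
  · rw [dist_comm]
    exact key s hs t ht h1 (hlt _ (by rw [abs_sub_comm]; exact le_abs_self _))

variable [IsManifold (𝓡 n) 1 M] [IsManifold (𝓡 n) 2 M] [T2Space M]
  [IsContMDiffRiemannianBundle (𝓡 n) 1 (EuclideanSpace ℝ (Fin n))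
    (fun x : M => TangentSpace (𝓡 n) x)]

/-- Along a minimizing segment issued from a stationary point, the potential decreases as half the
squared distance, and the other end point is not stationary. -/
lemma potential_eq_of_isSegment {S : M → ℝ} (hS : MDifferentiable (𝓡 n) 𝓘(ℝ, ℝ) S)
    (hlength : LengthIsDissipationLoss n S) {c : ℝ → M} {D : ℝ} (hD : 0 < D)
    (hc : IsSegment n c 0 D) (hp : IsStationaryPoint n S (c 0)) :
    S (c D) = S (c 0) - D ^ 2 / 2 ∧ ¬ IsStationaryPoint n S (c D) := by
  have h0 : (0 : ℝ) ∈ Icc 0 D := left_mem_Icc.2 hD.le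
  have hDm : D ∈ Icc 0 D := right_mem_Icc.2 hD.le
  have hmd := (hc.contMDiffOn hD).mdifferentiableOn one_ne_zero
  have hdiff : ∀ t ∈ Icc 0 D, DifferentiableWithinAt ℝ (fun s => S (c s)) (Icc 0 D) t :=
    fun t ht => ((hS (c t)).comp_mdifferentiableWithinAt t (hmd t ht)).differentiableWithinAt
  have hstat : ∀ t ∈ Icc 0 D, IsStationaryPoint n S (c t) → dissipation S c 0 D t = 0 := by
    intro t ht hst
    have hu := uniqueDiffOn_Icc hD t ht
    have h1 := mfderiv_comp_mfderivWithin t (hS (c t)) (hmd t ht) hu.uniqueMDiffWithinAt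
    rw [hst, mfderivWithin_eq_fderivWithin] at h1
    rw [dissipation, ← fderivWithin_derivWithin]
    have h2 : fderivWithin ℝ (S ∘ c) (Icc 0 D) t = 0 := h1.trans (ContinuousLinearMap.zero_comp _)
    change fderivWithin ℝ (S ∘ c) (Icc 0 D) t 1 = 0
    rw [h2]; rfl
  have hΦ0 := hstat 0 h0 hp
  have hΦ : ∀ t ∈ Icc 0 D, dissipation S c 0 D t = -t := by
    intro t ht
    rcases ht.1.eq_or_lt with rfl | hpos
    · rw [hΦ0, neg_zero]
    · have := hlength c 0 D hD (hc.isUnitGeodesic hD) 0 h0 t ht hpos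
      rw [hc.pathELength_eq hD h0 ht, sub_zero, ENNReal.toReal_ofReal ht.1, hΦ0] at this
      linarith
  refine ⟨?_, fun hst => ?_⟩
  -- `S (c s) + s ^ 2 / 2` has zero derivative, hence is constant.
  · have hder : ∀ t ∈ Icc 0 D,
        HasDerivWithinAt (fun s => S (c s) + s ^ 2 / 2) 0 (Icc 0 D) t := by
      intro t ht
      have h1 := (hdiff t ht).hasDerivWithinAt
      rw [show derivWithin (fun s => S (c s)) (Icc 0 D) t = -t from hΦ t ht] at h1
      have h2 : HasDerivWithinAt (fun s : ℝ => s ^ 2 / 2) t (Icc 0 D) t := by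
        have := ((hasDerivAt_pow 2 t).div_const 2).hasDerivWithinAt (s := Icc 0 D)
        simpa using this
      have h3 := h1.add h2
      rw [neg_add_cancel] at h3
      exact h3
    have := constant_of_derivWithin_zero (fun t ht => (hder t ht).differentiableWithinAt)
      (fun t ht => (hder t (Ico_subset_Icc_self ht)).derivWithin
        (uniqueDiffOn_Icc hD t (Ico_subset_Icc_self ht))) D hDm
    norm_num at this
    linarith
  · have h1 := hstat D hDm hst
    rw [hΦ D hDm] at h1
    linarith

end Potential

/-! ### From local segments to the global maximum. -/

section Metric

variable {n : ℕ} {M : Type*} [MetricSpace M] [ChartedSpace (EuclideanSpace ℝ (Fin n)) M]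
  [RiemannianBundle (fun x : M => TangentSpace (𝓡 n) x)]

lemma hasShortCurves_of_isRiemannianManifold [hM : IsRiemannianManifold (𝓡 n) M] :
    HasShortCurves M := by
  intro x y L hL
  have hL0 : 0 < L := dist_nonneg.trans_lt hL
  have hL' : riemannianEDist (𝓡 n) x y < ENNReal.ofReal L := by
    rw [← hM.out, edist_dist]
    exact (ENNReal.ofReal_lt_ofReal_iff hL0).2 hL
  obtain ⟨γ, rfl, rfl, hγ, hγL⟩ := exists_lt_of_riemannianEDist_lt hL'
  have hfin : pathELength (𝓡 n) γ 0 1 ≠ ⊤ := hγL.ne_top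
  set ℓ : ℝ → ℝ := fun u => (pathELength (𝓡 n) γ 0 u).toReal with hℓ
  have h0 : ℓ 0 = 0 := by simp [hℓ]
  have h1L : ℓ 1 ≤ L := ENNReal.toReal_le_of_le_ofReal hL0.le hγL.le
  have h1n : 0 ≤ ℓ 1 := ENNReal.toReal_nonneg
  have hdist : ∀ u ∈ Icc (0 : ℝ) 1, ∀ v ∈ Icc (0 : ℝ) 1, dist (γ u) (γ v) ≤ |ℓ u - ℓ v| := by
    have key : ∀ u ∈ Icc (0 : ℝ) 1, ∀ v ∈ Icc (0 : ℝ) 1, u ≤ v →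
        dist (γ u) (γ v) ≤ |ℓ u - ℓ v| := by
      intro u hu v hv huv
      have hf : ∀ s ∈ Icc (0 : ℝ) 1, ∀ t ∈ Icc (0 : ℝ) 1, pathELength (𝓡 n) γ s t ≠ ⊤ :=
        fun s hs t ht => ne_top_of_le_ne_top hfin (pathELength_mono hs.1 ht.2)
      have e : ℓ v = ℓ u + (pathELength (𝓡 n) γ u v).toReal := by
        simp only [hℓ]
        rw [← ENNReal.toReal_add (hf 0 ⟨le_rfl, zero_le_one⟩ u hu) (hf u hu v hv),
          pathELength_add hu.1 huv]
      rw [e, sub_add_cancel_left, abs_neg, abs_of_nonneg ENNReal.toReal_nonneg, dist_edist]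
      refine ENNReal.toReal_mono (hf u hu v hv) ?_
      rw [hM.out]
      exact riemannianEDist_le_pathELength (hγ.mono (Icc_subset_Icc hu.1 hv.2)) rfl rfl huv
    intro u hu v hv
    rcases le_total u v with h | h
    · exact key u hu v hv h
    · rw [dist_comm, abs_sub_comm]; exact key v hv u hu h
  -- Times at which the length is proportional to `s`. The choice `u` may jump where `γ` stands
  -- still, but distances along `γ ∘ u` are controlled by lengths alone.
  have hex : ∀ s ∈ Icc 0 L, ∃ u ∈ Icc (0 : ℝ) 1, ℓ u = s * (ℓ 1 / L) := by
    intro s hs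
    have := intermediate_value_Icc zero_le_one (continuousOn_pathELength_toReal hfin)
    refine this ⟨?_, ?_⟩
    · refine h0.trans_le ?_; exact mul_nonneg hs.1 (by positivity)
    · calc s * (ℓ 1 / L) ≤ L * (ℓ 1 / L) := mul_le_mul_of_nonneg_right hs.2 (by positivity)
        _ = ℓ 1 := by field_simp
  choose! u hu huℓ using hex
  have hL0m : (0 : ℝ) ∈ Icc 0 L := left_mem_Icc.2 hL0.le
  have hLm : L ∈ Icc 0 L := right_mem_Icc.2 hL0.le
  refine ⟨γ ∘ u, ?_, ?_, fun s hs t ht => ?_⟩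
  · refine dist_le_zero.1 ((hdist _ (hu 0 hL0m) 0 (by simp)).trans ?_)
    simp [huℓ 0 hL0m, h0]
  · refine dist_le_zero.1 ((hdist _ (hu L hLm) 1 (by simp)).trans ?_)
    rw [huℓ L hLm, mul_div_cancel₀ _ hL0.ne', sub_self, abs_zero]
  · refine (hdist _ (hu s hs) _ (hu t ht)).trans ?_
    rw [huℓ s hs, huℓ t ht, ← sub_mul, abs_mul, abs_of_nonneg (a := ℓ 1 / L) (by positivity)]
    exact mul_le_of_le_one_right (abs_nonneg _) ((div_le_one hL0).2 h1L)

lemma isSegment_of_dist_eq [hM : IsRiemannianManifold (𝓡 n) M] {c : ℝ → M} {a b : ℝ}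
    (hc : ∀ s ∈ Icc a b, ∀ t ∈ Icc a b, dist (c s) (c t) = |s - t|) : IsSegment n c a b where
  continuousOn := (LipschitzOnWith.of_dist_le_mul (K := 1) fun s hs t ht => by
    rw [hc s hs t ht, NNReal.coe_one, one_mul, Real.dist_eq]).continuousOn
  edist_eq s hs t ht := by rw [← hM.out, edist_dist, hc s hs t ht]

/-- If the length of geodesics is the loss of dissipation and the weight vanishes at infinity, then
a stationary point of the potential is its strict global maximum and its only stationary point. -/
lemma potential_lt_of_isStationaryPoint [IsRiemannianManifold (𝓡 n) M] [LocallyCompactSpace M]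
    [IsManifold (𝓡 n) 1 M] [IsManifold (𝓡 n) 2 M]
    [IsContMDiffRiemannianBundle (𝓡 n) 1 (EuclideanSpace ℝ (Fin n))
      (fun x : M => TangentSpace (𝓡 n) x)]
    {S : M → ℝ} (hS : MDifferentiable (𝓡 n) 𝓘(ℝ, ℝ) S)
    (hlength : LengthIsDissipationLoss n S)
    (hboundary : Tendsto (probabilityWeight S) (cocompact M) (𝓝 0))
    {p y : M} (hp : IsStationaryPoint n S p) (hy : y ≠ p) :
    S y < S p ∧ ¬ IsStationaryPoint n S y := by
  have hX : HasShortCurves M := hasShortCurves_of_isRiemannianManifold (n := n)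
  have main : ∀ {R : ℝ} {K : Set M}, IsCompact K → Metric.ball p R ⊆ K → ∀ {y : M}, dist p y < R →
      y ≠ p → S y = S p - dist p y ^ 2 / 2 ∧ ¬ IsStationaryPoint n S y := by
    intro R K hK hR y hy hne
    obtain ⟨c, hc0, hcD, hc⟩ := exists_segment_of_ball_subset_isCompact hX hK hR hy
    have := potential_eq_of_isSegment hS hlength (dist_pos.2 hne.symm)
      (isSegment_of_dist_eq (n := n) hc) (hc0.symm ▸ hp)
    rwa [hc0, hcD] at this
  have hballs := exists_isCompact_ball_subset hX p (fun R hR => by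
    -- By the formula on smaller balls, `S` is at least `S p - R ^ 2 / 2` on the ball of radius `R`,
    -- so no point of it lies where the weight is below this threshold.
    have hev : ∀ᶠ x in cocompact M, probabilityWeight S x < Real.exp (S p - R ^ 2 / 2) :=
      hboundary.eventually (gt_mem_nhds (Real.exp_pos _))
    obtain ⟨K, hK, hKs⟩ := mem_cocompact.1 hev
    refine ⟨K, hK, fun y hy => by_contra fun hyK => ?_⟩
    have hlt : S y < S p - R ^ 2 / 2 := Real.exp_lt_exp.1 (hKs hyK)
    rcases eq_or_ne y p with rfl | hne
    · nlinarith [sq_nonneg R]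
    rw [Metric.mem_ball'] at hy
    obtain ⟨r, hyr, hrR⟩ := exists_between hy
    obtain ⟨K', hK', hrK'⟩ := hR r hrR
    have hSy := (main hK' hrK' hyr hne).1
    have : dist p y ^ 2 ≤ R ^ 2 := by gcongr
    linarith) (dist p y + 1)
  obtain ⟨K, hK, hKs⟩ := hballs
  obtain ⟨h1, h2⟩ := main hK hKs (lt_add_one _) hy
  have := dist_pos.2 hy.symm
  exact ⟨by rw [h1]; linarith [pow_pos this 2], h2⟩

end Metric

/-- A version of `potential_lt_of_isStationaryPoint` where the distance is not given. -/
lemma potential_lt_of_isStationaryPoint_of_preconnectedSpace {n : ℕ} {M : Type*}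
    [TopologicalSpace M] [T2Space M] [PreconnectedSpace M]
    [ChartedSpace (EuclideanSpace ℝ (Fin n)) M] [IsManifold (𝓡 n) 1 M] [IsManifold (𝓡 n) 2 M]
    [RiemannianBundle (fun x : M => TangentSpace (𝓡 n) x)]
    [IsContMDiffRiemannianBundle (𝓡 n) 1 (EuclideanSpace ℝ (Fin n))
      (fun x : M => TangentSpace (𝓡 n) x)]
    {S : M → ℝ} (hS : MDifferentiable (𝓡 n) 𝓘(ℝ, ℝ) S)
    (hlength : LengthIsDissipationLoss n S)
    (hboundary : Tendsto (probabilityWeight S) (cocompact M) (𝓝 0))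
    {p y : M} (hp : IsStationaryPoint n S p) (hy : y ≠ p) :
    S y < S p ∧ ¬ IsStationaryPoint n S y := by
  have : LocallyCompactSpace M := ChartedSpace.locallyCompactSpace (EuclideanSpace ℝ (Fin n)) M
  have := isContinuousRiemannianBundle_of_contMDiff (n := n) (M := M)
  let : EMetricSpace M := .ofRiemannianMetric (𝓡 n) M
  let : MetricSpace M := EMetricSpace.toMetricSpace edist_ne_top_of_preconnectedSpace
  have : IsRiemannianManifold (𝓡 n) M := ⟨fun x y => rfl⟩
  exact potential_lt_of_isStationaryPoint hS hlength hboundary hp hy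

lemma isStationaryPoint_of_forall_le {n : ℕ} {M : Type*} [TopologicalSpace M]
    [ChartedSpace (EuclideanSpace ℝ (Fin n)) M] {S : M → ℝ} {p : M} (hp : ∀ x, S x ≤ S p) :
    IsStationaryPoint n S p := by
  by_cases h : MDifferentiableAt (𝓡 n) 𝓘(ℝ, ℝ) S p
  · have hmax : IsLocalMax (writtenInExtChartAt (𝓡 n) 𝓘(ℝ, ℝ) p S) (extChartAt (𝓡 n) p p) := by
      refine Eventually.of_forall fun z => ?_
      change S ((extChartAt (𝓡 n) p).symm z) ≤
        S ((extChartAt (𝓡 n) p).symm (extChartAt (𝓡 n) p p))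
      rw [extChartAt_to_inv]
      exact hp _
    have : range (𝓡 n) = univ := by simp
    refine h.mfderiv.trans ?_
    rw [this, fderivWithin_univ]
    exact hmax.fderiv_eq_zero
  -- The derivative is zero by convention where `S` is not differentiable.
  · exact mfderiv_zero_of_not_mdifferentiableAt h

end FluctuationGeometry

theorem theorem3 {n : ℕ} {M : Type*} [TopologicalSpace M] [T2Space M]
    [SecondCountableTopology M] [SimplyConnectedSpace M]
    [ChartedSpace (EuclideanSpace ℝ (Fin n)) M] [IsManifold (𝓡 n) ∞ M]
    [RiemannianBundle (fun x : M => TangentSpace (𝓡 n) x)]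
    [IsContMDiffRiemannianBundle (𝓡 n) 2 (EuclideanSpace ℝ (Fin n))
      (fun x : M => TangentSpace (𝓡 n) x)]
    [MeasurableSpace M] [BorelSpace M]
    -- the invariant volume element
    (μ : Measure M) (hμ : FluctuationGeometry.IsInvariantVolume n μ)
    -- the information potential, with probability distribution `dp = exp S dμ`
    (S : M → ℝ) (hS : MDifferentiable (𝓡 n) 𝓘(ℝ, ℝ) S)
    (hp : IsProbabilityMeasure
      (μ.withDensity fun x => ENNReal.ofReal (FluctuationGeometry.probabilityWeight S x)))
    -- geodesic length is the loss of information dissipation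
    (hlength : FluctuationGeometry.LengthIsDissipationLoss n S)
    -- the probability weight vanishes on the (ideal) boundary of `M`
    (hboundary : Tendsto (FluctuationGeometry.probabilityWeight S) (cocompact M) (𝓝 0)) :
    ∃ Ibar : M,
      (∀ x : M, FluctuationGeometry.IsStationaryPoint n S x ↔ x = Ibar) ∧
      ∀ x : M, x ≠ Ibar → S x < S Ibar := by
  have hexp : Continuous (FluctuationGeometry.probabilityWeight S) :=
    Real.continuous_exp.comp hS.continuous
  obtain ⟨x₀⟩ := (inferInstance : Nonempty M)
  -- Outside a compact set the weight is below its value at `x₀`, so a global maximum exists.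
  obtain ⟨p, hp⟩ := hexp.exists_forall_ge' x₀ ((hboundary.eventually
    (gt_mem_nhds (Real.exp_pos (S x₀)))).mono fun _ h => h.le)
  have hmax : ∀ x, S x ≤ S p := fun x => Real.exp_le_exp.1 (hp x)
  have hstat := FluctuationGeometry.isStationaryPoint_of_forall_le (n := n) hmax
  have hlt := fun x hx => FluctuationGeometry.potential_lt_of_isStationaryPoint_of_preconnectedSpace
    (y := x) hS hlength hboundary hstat hx
  refine ⟨p, fun x => ⟨fun hx => ?_, fun hx => hx ▸ hstat⟩, fun x hx => (hlt x hx).1⟩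
  by_contra hne
  exact (hlt x hne).2 hx
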